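/- **Setting.** Let $\mathbb K\in\{\mathbb R,\mathbb C,\mathbb H\}$; quaternions are identified with the complex $2\times2$ matrices $a$ satisfying $I^*\overline aI=a$, $I=\left(\begin{smallmatrix}0&-1\\1&0\end{smallmatrix}\right)$, so that matrices over $\mathbb K$ are complex matrices. $\mathrm{Tr}$ is the complex trace for $\mathbb K=\mathbb R,\mathbb C$ and half of it for $\mathbb K=\mathbb H$, and $\tau$ is this trace on a single scalar of $\mathbb K$. Put $\mathcal J=\left(\begin{smallmatrix}0&-\mathbf 1\\ \mathbf 1&0\end{smallmatrix}\right)$ and $\mathcal C=\frac1{\sqrt2}\left(\begin{smallmatrix}\mathbf 1&-\imath\mathbf 1\\ \mathbf 1&\imath\mathbf 1\end{smallmatrix}\right)$ with $L\times L$ blocks over $\mathbb K$; let $\mathrm{hs}(2L,\mathbb K)$ be the matrices $\mathcal P\in\mathrm{Mat}(2L\times2L,\mathbb K)$ with $\mathcal P^*\mathcal J+\mathcal J\mathcal P=0$, and let $\mathbb I(L,\mathbb K)=\{\Phi\in\mathrm{Mat}(2L\times L,\mathbb K):\Phi^*\Phi=\mathbf 1,\ \Phi^*\mathcal J\Phi=0\}$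 be the isotropic frames. For $\Phi\in\mathbb I(L,\mathbb K)$ write $\mathcal C\Phi=\frac1{\sqrt2}\left(\begin{smallmatrix}U\\V\end{smallmatrix}\right)$ with unitary $U,V$. A matrix $\mathcal T$ with $\mathcal T^*\mathcal J\mathcal T=\mathcal J$ acts on frames by letting $\mathcal T\cdot\Phi$ be the Gram–Schmidt orthonormalization of the columns of $\mathcal T\Phi$; then $\mathcal T\Phi=(\mathcal T\cdot\Phi)S(\mathcal T,\Phi)$ with $S(\mathcal T,\Phi)$ upper triangular with positive diagonal, and $g_p(\mathcal T,\Phi)=\tau\log(e_p^*S(\mathcal T,\Phi)e_p)$. Let $0\le L_h\le L$ and $L_e=L-L_h$; the channels $p\le L_h$ are called hyperbolic, the channels $p>L_h$ elliptic. Let $\mathcal T_n=\mathcal R_e\mathcal R_he^{\lambda\mathcal P_n}$, where $\mathcal R_h=\mathrm{diag}(\kappa,(\kappa^*)^{-1})$ with $\kappa=\mathrm{diag}(\kappa_1,\dots,\kappa_L)$, $\kappa_l\in\mathbb K$, $|\kappa_1|>\dots>|\kappa_{L_h}|>1=\kappa_{L_h+1}=\dots=\kappa_L$; where $\mathcal R_e=\left(\begin{smallmatrix}\cos\eta&-\sin\eta\\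 \sin\eta&\cos\eta\end{smallmatrix}\right)$ with $\eta$ real diagonal and $\eta_l=0$ for $l\le L_h$; and where the $\mathcal P_n\in\mathrm{hs}(2L,\mathbb K)$ are i.i.d., centered and square integrable (with the law of $\mathcal P$). Let $\pi_e$ be the $L\times L$ projection on the elliptic channels, $\pi_h=\mathbf 1-\pi_e$, $\Pi_e=\mathrm{diag}(\pi_e,\pi_e)$. Let $\delta_C,\delta_R,\delta_H$ be $1$ if $\mathbb K$ is $\mathbb C,\mathbb R,\mathbb H$ respectively, and $0$ otherwise. **Random Phase Property (RPP), an assumption.** For all sufficiently small $\lambda>0$ the Markov process $\Phi_n=\mathcal T_n\cdot\Phi_{n-1}$ on $\mathbb I(L,\mathbb K)$ has an invariant probability measure, and it is unique; and there is a probability measure $\mu_0$ on $\mathbb I(L,\mathbb K)$ with the properties (R1) $U=\pi_eU\pi_e+\pi_hU\pi_h$; (R2) $\pi_hU\pi_h=\pi_h$; (R3) $\pi_eU\pi_e$ is Haar distributed on $\mathrm U(L_e)$ if $\mathbb K=\mathbb R,\mathbb C$ and on $\mathrm U(2L_e)$ if $\mathbb K=\mathbb H$; (R4) if $\mathbb K=\mathbb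 C$, then $U$ and $V$ are independent and identically distributed; such that for every smooth observable the average with respect to the invariant measure equals the one with respect to $\mu_0$ up to an error $O(\lambda^2)$ as $\lambda\downarrow0$. Uniqueness and closeness are understood on the flag manifold, i.e. for sets and observables invariant under $\Phi\mapsto\Phi D$ for all diagonal unitaries $D$ over $\mathbb K$. **Theorem.** Assume the RPP. For small $\lambda>0$ let $\mu_\lambda$ be an invariant probability measure on $\mathbb I(L,\mathbb K)$, and for $p>L_h$ let $$ G_p(\lambda)=\frac{\lambda^2}{4}\,\mathbf E\,\tau\Big(e_p^*\Phi^*(2\mathcal P^*\mathcal P+\mathcal P^2+(\mathcal P^*)^2)\Phi e_p-\sum_{q=1}^p(2-\delta_{q,p})\,e_p^*\Phi^*(\mathcal P^*+\mathcal P)\Phi e_q\,e_q^*\Phi^*(\mathcal P^*+\mathcal P)\Phi e_p\Big), $$ where $\mathcal P$ and $\Phi\sim\mu_\lambda$ are independent. Put $T=\mathbf E\,\mathrm{Tr}[\Pi_e(\mathcal P^*+\mathcal P)\Pi_e\mathcal P\Pi_e]$. 1. For every elliptic channel $p>L_h$, as $\lambda\downarrow0$, $$ G_p(\lambda)=\frac{\lambda^2}{4L_e(L_e+\delta_R-\frac12\delta_H)}\Big(L-p+\tfrac12\delta_C+\delta_R+\tfrac14\delta_H\Big)\,T+O(\lambda^3).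 $$ 2. Suppose moreover that for every elliptic channel the Lyapunov exponents $\gamma_p(\lambda)=\lim_{N\to\infty}\frac1N\sum_{n=1}^Ng_p(\mathcal T_n,\Phi_{n-1})$ (for every initial frame $\Phi_0$, almost surely) are given by the second-order expression, i.e. $\gamma_p(\lambda)=G_p(\lambda)+O(\lambda^3)$. Then for all $p>L_h$ $$ \gamma_p(\lambda)=\frac{\lambda^2}{4L_e(L_e+\delta_R-\frac12\delta_H)}\Big(L-p+\tfrac12\delta_C+\delta_R+\tfrac14\delta_H\Big)\,T+O(\lambda^3), $$ and the elliptic Lyapunov spectrum is equidistant: for $L_h<p<L$ $$ \gamma_p(\lambda)-\gamma_{p+1}(\lambda)=\frac{\lambda^2\,T}{4L_e(L_e+\delta_R-\frac12\delta_H)}+O(\lambda^3). $$ 3. Consider three such systems as in 2, one for each of $\mathbb K=\mathbb R,\mathbb C,\mathbb H$, with the same number $L_e=n\ge1$ of elliptic channels and the same $T>0$, and let $\ell^{\mathbb K}(\lambda)=1/\gamma_L^{\mathbb K}(\lambda)$ be their localization lengths. Then $$ \lim_{\lambda\downarrow0}\frac{\ell^{\mathbb C}(\lambda)}{\ell^{\mathbb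 R}(\lambda)}=\frac{2n}{n+1},\qquad \lim_{\lambda\downarrow0}\frac{\ell^{\mathbb H}(\lambda)}{\ell^{\mathbb C}(\lambda)}=\frac{2n-1}{n}, $$ and both limits tend to $2$ as $n\to\infty$. -/

import Mathlib

open MeasureTheory ProbabilityTheory Filter Topology Asymptotics
open scoped Matrix ContDiff

noncomputable section

namespace RandomPhase

/-! ### The three symmetry classes

Matrices with entries in `𝕂 = ℝ, ℂ, ℍ` are complex matrices; a quaternion is a complex
`2 × 2` block `a` with `I* ā I = a`, where `I = [[0, -1], [1, 0]]`. -/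

/-- The symmetry class, i.e. the number field `𝕂 = ℝ, ℂ, ℍ`
(orthogonal, unitary and symplectic class). -/
inductive SymClass : Type
  | real
  | complex
  | quaternion

namespace SymClass

/-- The size of the complex block which represents one scalar of `𝕂`. -/
abbrev dim : SymClass → ℕ
  | real => 1
  | complex => 1
  | quaternion => 2

/-- The Kronecker delta `δ_{𝕂,ℝ}`. -/
def deltaR : SymClass → ℝ
  | real => 1
  | complex => 0
  | quaternion => 0

/-- The Kronecker delta `δ_{𝕂,ℂ}`. -/
def deltaC : SymClass → ℝ
  | real => 0
  | complex => 1
  | quaternion => 0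

/-- The Kronecker delta `δ_{𝕂,ℍ}`. -/
def deltaH : SymClass → ℝ
  | real => 0
  | complex => 0
  | quaternion => 1

end SymClass

/-- The matrix `I = diag(I, …, I)` built from `2 × 2` blocks `[[0, -1], [1, 0]]`. -/
def qI (n : Type) [DecidableEq n] : Matrix (n × Fin 2) (n × Fin 2) ℂ :=
  Matrix.kronecker (1 : Matrix n n ℂ) !![0, -1; 1, 0]

/-- `A` has entries in `𝕂`: no condition for `ℂ`, `Ā = A` for `ℝ`, `I* Ā I = A` for `ℍ`. -/
def IsOver {m n : Type} [Fintype m] [DecidableEq m] [Fintype n] [DecidableEq n] :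
    (K : SymClass) → Matrix (m × Fin K.dim) (n × Fin K.dim) ℂ → Prop
  | .real, A => A.map star = A
  | .complex, _ => True
  | .quaternion, A => (qI m)ᴴ * A.map star * qI n = A

/-- Index set of the channels: `L` channels, each with one scalar of `𝕂`. -/
abbrev Ix (K : SymClass) (L : ℕ) : Type := Fin L × Fin K.dim

/-- `Mat(L × L, 𝕂)`, inside the complex matrices. -/
abbrev SMat (K : SymClass) (L : ℕ) : Type := Matrix (Ix K L) (Ix K L) ℂ

/-- `Mat(2L × 2L, 𝕂)`, inside the complex matrices. -/
abbrev BMat (K : SymClass) (L : ℕ) : Type := Matrix (Ix K L ⊕ Ix K L) (Ix K L ⊕ Ix K L) ℂ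

/-- `Mat(2L × L, 𝕂)`, inside the complex matrices. -/
abbrev FMat (K : SymClass) (L : ℕ) : Type := Matrix (Ix K L ⊕ Ix K L) (Ix K L) ℂ

/-- Complex matrices carry the product (Borel) σ-algebra of their entries. -/
instance instMeasurableSpaceMatrix {m n : Type} : MeasurableSpace (Matrix m n ℂ) :=
  inferInstanceAs (MeasurableSpace (m → n → ℂ))

variable {K : SymClass} {L : ℕ}

/-- `Tr`, with the factor `1/2` in the quaternion case; on a single block this is `τ`. -/
def trK {n : Type} [Fintype n] (K : SymClass) (A : Matrix n n ℂ) : ℂ :=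
  (K.dim : ℂ)⁻¹ * A.trace

/-- The scalar `e_p^* X e_q ∈ 𝕂`, as a complex block. -/
def entry (X : SMat K L) (p q : Fin L) : Matrix (Fin K.dim) (Fin K.dim) ℂ :=
  Matrix.of fun s t => X (p, s) (q, t)

/-- The matrix `diag(a_1, …, a_L)` with `a_l ∈ 𝕂`. -/
def diagK (a : Fin L → Matrix (Fin K.dim) (Fin K.dim) ℂ) : SMat K L :=
  Matrix.of fun i j => if i.1 = j.1 then a i.1 i.2 j.2 else 0

/-- The real scalar matrix `diag(x_1, …, x_L)`. -/
def rdiag (K : SymClass) (x : Fin L → ℝ) : SMat K L :=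
  Matrix.diagonal fun i => (x i.1 : ℂ)

/-- The norm of a vector with entries in `𝕂`, or the modulus of a scalar in `𝕂`. -/
def normK {n : Type} [Fintype n] (v : Matrix n (Fin K.dim) ℂ) : ℝ :=
  Real.sqrt (trK K (vᴴ * v)).re

/-- A `2L × 2L` matrix has entries in `𝕂`. -/
def IsOverB (A : BMat K L) : Prop :=
  IsOver K A.toBlocks₁₁ ∧ IsOver K A.toBlocks₁₂ ∧ IsOver K A.toBlocks₂₁ ∧ IsOver K A.toBlocks₂₂

/-! ### Hermitian symplectic Lie algebra, isotropic frames and the action -/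

/-- The symplectic form `𝒥 = [[0, -1], [1, 0]]`. -/
def symJ (K : SymClass) (L : ℕ) : BMat K L := Matrix.J (Ix K L) ℂ

/-- The Cayley transform `𝒞 = 2^{-1/2} [[1, -i], [1, i]]`. -/
def cayley (K : SymClass) (L : ℕ) : BMat K L :=
  ((Real.sqrt 2 : ℝ) : ℂ)⁻¹ •
    Matrix.fromBlocks 1 (-(Complex.I • (1 : SMat K L))) 1 (Complex.I • (1 : SMat K L))

/-- The Lie algebra `hs(2L, 𝕂)` of `HS(2L, 𝕂) = {T | T* 𝒥 T = 𝒥}`. -/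
def IsHS (P : BMat K L) : Prop :=
  IsOverB P ∧ Pᴴ * symJ K L + symJ K L * P = 0

/-- The isotropic frames `𝕀(L, 𝕂)`. -/
def IsFrame (Φ : FMat K L) : Prop :=
  IsOver K Φ.toRows₁ ∧ IsOver K Φ.toRows₂ ∧ Φᴴ * Φ = 1 ∧ Φᴴ * symJ K L * Φ = 0

/-- The unitary `U` in `𝒞 Φ = 2^{-1/2} (U ; V)`. -/
def phaseU (Φ : FMat K L) : SMat K L :=
  ((Real.sqrt 2 : ℝ) : ℂ) • (cayley K L * Φ).toRows₁

/-- The unitary `V` in `𝒞 Φ = 2^{-1/2} (U ; V)`. -/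
def phaseV (Φ : FMat K L) : SMat K L :=
  ((Real.sqrt 2 : ℝ) : ℂ) • (cayley K L * Φ).toRows₂

/-- The diagonal unitaries with entries in `𝕂`. Two frames `Φ`, `Φ'` span the same flag
of `𝕂`-subspaces exactly if `Φ' = Φ D` for such a `D`. -/
def IsGauge (D : SMat K L) : Prop :=
  IsOver K D ∧ Dᴴ * D = 1 ∧ ∀ p q, p ≠ q → entry D p q = 0

/-- The `p`-th column `φ_p ∈ 𝕂^{2L}` of a `2L × L` matrix. -/
def col (Φ : FMat K L) (p : Fin L) : Matrix (Ix K L ⊕ Ix K L) (Fin K.dim) ℂ :=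
  Matrix.of fun i s => Φ i (p, s)

/-- The normalized Gram-Schmidt vectors `φ'_p = φ''_p / ‖φ''_p‖` of the columns of `A`,
where `φ''_p = a_p - ∑_{q < p} φ'_q (φ'_q)^* a_p`. -/
def gsCol (A : FMat K L) (p : Fin L) : Matrix (Ix K L ⊕ Ix K L) (Fin K.dim) ℂ :=
  let y := col A p - ∑ q : Fin p.1,
    gsCol A ⟨q.1, q.2.trans p.2⟩ * ((gsCol A ⟨q.1, q.2.trans p.2⟩)ᴴ * col A p)
  ((normK y : ℝ) : ℂ)⁻¹ • y
termination_by p.1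
decreasing_by all_goals exact q.2

/-- The action `T · Φ`: Gram-Schmidt applied to the columns of `T Φ`. -/
def act (T : BMat K L) (Φ : FMat K L) : FMat K L :=
  Matrix.of fun i j => gsCol (T * Φ) j.1 i j.2

/-- The upper triangular `S(T, Φ)` with `T Φ = (T · Φ) S(T, Φ)`. -/
def cocycleS (T : BMat K L) (Φ : FMat K L) : SMat K L :=
  (act T Φ)ᴴ * (T * Φ)

/-- The additive cocycle `g_p(T, Φ) = log (e_p^* S(T, Φ) e_p)`; in the quaternion case
the diagonal entry is a real multiple of the identity block, which `τ` extracts. -/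
def cocycleG (T : BMat K L) (Φ : FMat K L) (p : Fin L) : ℝ :=
  Real.log (trK K (entry (cocycleS T Φ) p p)).re

/-- The orbit `Φ_n = T_n · Φ_{n-1}` (the matrix `T n` stands for `T_{n+1}`). -/
def orbit (T : ℕ → BMat K L) (Φ₀ : FMat K L) : ℕ → FMat K L
  | 0 => Φ₀
  | n + 1 => act (T n) (orbit T Φ₀ n)

/-! ### Transfer matrices in normal form -/

/-- Random transfer matrices `R e^{λ P_n}` in normal form with `L` channels, the first `Lh` of
them hyperbolic: the expansion factors `κ_l ∈ 𝕂`, the rotation angles `η_l`, and the law of the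
i.i.d. centered, square integrable Lie algebra elements `P_n`. -/
structure Model (K : SymClass) (L : ℕ) where
  Lh : ℕ
  Lh_le : Lh ≤ L
  κ : Fin L → Matrix (Fin K.dim) (Fin K.dim) ℂ
  κ_over : IsOver K (diagK κ)
  κ_strict : ∀ i j : Fin L, i < j → j.1 < Lh → normK (κ j) < normK (κ i)
  κ_hyp : ∀ i : Fin L, i.1 < Lh → 1 < normK (κ i)
  κ_ell : ∀ i : Fin L, Lh ≤ i.1 → κ i = 1
  η : Fin L → ℝ
  η_hyp : ∀ i : Fin L, i.1 < Lh → η i = 0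
  law : Measure (BMat K L)
  law_prob : IsProbabilityMeasure law
  law_hs : ∀ᵐ P ∂law, IsHS P
  law_sq : ∀ i j, MemLp (fun P : BMat K L => P i j) 2 law
  law_centered : ∀ i j, ∫ P : BMat K L, P i j ∂law = 0

attribute [instance] Model.law_prob

namespace Model

variable (M : Model K L)

/-- The number of elliptic channels. -/
def Le : ℕ := L - M.Lh

/-- The expansion matrix `R_h = diag(κ, (κ*)⁻¹)`. -/
def Rh : BMat K L := Matrix.fromBlocks (diagK M.κ) 0 0 ((diagK M.κ)ᴴ)⁻¹

/-- The rotation matrix `R_e`. -/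
def Re : BMat K L :=
  Matrix.fromBlocks
    (rdiag K fun l => Real.cos (M.η l)) (-(rdiag K fun l => Real.sin (M.η l)))
    (rdiag K fun l => Real.sin (M.η l)) (rdiag K fun l => Real.cos (M.η l))

/-- The transfer matrix `R e^{λ P}` with `R = R_e R_h`. -/
def transfer (lam : ℝ) (P : BMat K L) : BMat K L :=
  M.Re * M.Rh * NormedSpace.exp ((lam : ℂ) • P)

/-- The projection `π_e` on the elliptic channels. -/
def piE : SMat K L := rdiag K fun l => if M.Lh ≤ l.1 then 1 else 0

/-- The projection `π_h` on the hyperbolic channels. -/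
def piH : SMat K L := 1 - M.piE

/-- The projection `Π_e = diag(π_e, π_e)`. -/
def PiE : BMat K L := Matrix.fromBlocks M.piE 0 0 M.piE

/-- `μ` is an invariant probability measure on `𝕀(L, 𝕂)` of the Markov process
`Φ_n = R e^{λ P_n} · Φ_{n-1}`. -/
def IsInvariant (lam : ℝ) (μ : Measure (FMat K L)) : Prop :=
  IsProbabilityMeasure μ ∧ (∀ᵐ Φ ∂μ, IsFrame Φ) ∧
    (M.law.prod μ).map (fun x => act (M.transfer lam x.1) x.2) = μ

/-- Index set of the elliptic channels. -/
abbrev EIx : Type := {i : Ix K L // M.Lh ≤ i.1.1}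

/-- `π_e U π_e` as a matrix of size `L_e × L_e` over `𝕂`-sized blocks. -/
def blockE (U : SMat K L) : Matrix M.EIx M.EIx ℂ :=
  U.submatrix Subtype.val Subtype.val

end Model

/-- `ρ` is the Haar probability measure of the unitary group (the unique translation invariant
probability measure on this compact group), seen as a measure on matrices. -/
def IsHaarUnitary {n : Type} [Fintype n] [DecidableEq n] (ρ : Measure (Matrix n n ℂ)) : Prop :=
  IsProbabilityMeasure ρ ∧ (∀ᵐ U ∂ρ, U ∈ Matrix.unitaryGroup n ℂ) ∧
    ∀ W ∈ Matrix.unitaryGroup n ℂ, ρ.map (fun U => W * U) = ρ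

namespace Model

variable (M : Model K L)

/-- The geometric measure of the random phase property: a probability measure on `𝕀(L, 𝕂)`
for which
* `U = π_e U π_e + π_h U π_h`,
* `π_h U π_h = π_h`,
* `π_e U π_e` is Haar distributed on `U(L_e)` for `𝕂 = ℝ, ℂ` and on `U(2 L_e)` for `𝕂 = ℍ`,
* for `𝕂 = ℂ`, `U` and `V` are independent and identically distributed. -/
structure IsGeometric (μ : Measure (FMat K L)) : Prop where
  prob : IsProbabilityMeasure μ
  frame : ∀ᵐ Φ ∂μ, IsFrame Φ
  split : ∀ᵐ Φ ∂μ, phaseU Φ = M.piE * phaseU Φ * M.piE + M.piH * phaseU Φ * M.piH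
  hyperbolic : ∀ᵐ Φ ∂μ, M.piH * phaseU Φ * M.piH = M.piH
  haar : IsHaarUnitary (μ.map fun Φ => M.blockE (phaseU Φ))
  indep : K = SymClass.complex →
    IndepFun (phaseU (K := K) (L := L)) phaseV μ ∧ μ.map phaseU = μ.map phaseV

/-- The random phase property. For small `λ > 0` the invariant measure exists and is unique,
and averages of smooth observables agree with those of the geometric measure with
errors `O(λ²)`. Both are understood on the flag manifold `𝕀(L, 𝕂) / {diagonal unitaries}`, i.e. for
sets and observables that do not change under `Φ ↦ Φ D`: the action commutes with these maps,
so that on the frames themselves an invariant measure is only determined up to them. -/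
def RandomPhaseProperty : Prop :=
  (∀ᶠ lam : ℝ in 𝓝[>] 0,
    (∃ μ, M.IsInvariant lam μ) ∧
    ∀ μ μ' : Measure (FMat K L), M.IsInvariant lam μ → M.IsInvariant lam μ' →
      ∀ s : Set (FMat K L), MeasurableSet s →
        (∀ Φ D, IsFrame Φ → IsGauge D → (Φ * D ∈ s ↔ Φ ∈ s)) → μ s = μ' s) ∧
  ∃ μ₀ : Measure (FMat K L), M.IsGeometric μ₀ ∧
    ∀ f : FMat K L → ℝ,
      ContDiff ℝ ∞ (fun x : Ix K L ⊕ Ix K L → Ix K L → ℂ => f (Matrix.of x)) →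
      (∀ Φ D, IsFrame Φ → IsGauge D → f (Φ * D) = f Φ) →
      ∀ μ : ℝ → Measure (FMat K L), (∀ᶠ lam : ℝ in 𝓝[>] 0, M.IsInvariant lam (μ lam)) →
        (fun lam : ℝ => ∫ Φ, f Φ ∂(μ lam) - ∫ Φ, f Φ ∂μ₀) =O[𝓝[>] 0] fun lam : ℝ => lam ^ 2

/-! ### Lyapunov exponents -/

/-- `g` is the `p`-th Lyapunov exponent at coupling `λ`: for every initial frame, almost surely,
`N⁻¹ ∑_{n=1}^N g_p(T_n, Φ_{n-1}) → g` for i.i.d. `P_n` and `T_n = R e^{λ P_n}`. -/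
def IsLyapunovExponent (lam : ℝ) (p : Fin L) (g : ℝ) : Prop :=
  ∀ Φ₀ : FMat K L, IsFrame Φ₀ →
    ∀ᵐ P ∂(Measure.infinitePi fun _ : ℕ => M.law),
      Tendsto (fun N : ℕ => (N : ℝ)⁻¹ * ∑ n ∈ Finset.range N,
        cocycleG (M.transfer lam (P n)) (orbit (fun k => M.transfer lam (P k)) Φ₀ n) p)
        atTop (𝓝 g)

/-- The second order expression
`λ²/4 · E τ( e_p^* Φ^*(2P^*P + P² + (P^*)²)Φ e_p
  - ∑_{q ≤ p} (2 - δ_{q,p}) e_p^* Φ^*(P^* + P)Φ e_q e_q^* Φ^*(P^* + P)Φ e_p )`,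
the expectation being over independent `P` and `Φ`, with `Φ` distributed according to `μ`. -/
def secondOrder (μ : Measure (FMat K L)) (lam : ℝ) (p : Fin L) : ℝ :=
  lam ^ 2 / 4 * ∫ x : BMat K L × FMat K L,
    (trK K
      (entry (x.2ᴴ * ((2 : ℂ) • (x.1ᴴ * x.1) + x.1 * x.1 + x.1ᴴ * x.1ᴴ) * x.2) p p
        - ∑ q ∈ Finset.Iic p, (if q = p then (1 : ℂ) else 2) •
            (entry (x.2ᴴ * (x.1ᴴ + x.1) * x.2) p q *
              entry (x.2ᴴ * (x.1ᴴ + x.1) * x.2) q p))).re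
    ∂(M.law.prod μ)

/-- The disorder strength `E Tr[Π_e (P^* + P) Π_e P Π_e]` of the elliptic channels. -/
def strength : ℝ :=
  ∫ P : BMat K L, (trK K (M.PiE * (Pᴴ + P) * M.PiE * P * M.PiE)).re ∂M.law

/-- The `γ λ p` are the Lyapunov exponents of the elliptic channels for small `λ > 0`, and they
are given by the second order expression with errors `O(λ³)`, the frames being distributed
according to the invariant measures `μ λ`. -/
def ExponentsGivenBy (μ : ℝ → Measure (FMat K L)) (γ : ℝ → Fin L → ℝ) : Prop :=
  (∀ᶠ lam : ℝ in 𝓝[>] 0, M.IsInvariant lam (μ lam)) ∧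
  ∀ p : Fin L, M.Lh ≤ p.1 →
    (∀ᶠ lam : ℝ in 𝓝[>] 0, M.IsLyapunovExponent lam p (γ lam p)) ∧
    (fun lam : ℝ => γ lam p - M.secondOrder (μ lam) lam p) =O[𝓝[>] 0] fun lam : ℝ => lam ^ 3

/-- The spacing `E Tr[Π_e (P^* + P) Π_e P Π_e] / (4 L_e (L_e + δ_{𝕂,ℝ} - δ_{𝕂,ℍ}/2))`, in
units of `λ²`. -/
def spacing : ℝ :=
  1 / (4 * (M.Le : ℝ) * ((M.Le : ℝ) + K.deltaR - K.deltaH / 2)) * M.strength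

/-- The value `spacing · (L - p + δ_{𝕂,ℂ}/2 + δ_{𝕂,ℝ} + δ_{𝕂,ℍ}/4)` of the coefficient of `λ²`;
channels are numbered from `0` in `Fin L`, so that the `p` of the formula is `p + 1` here. -/
def coefficient (p : Fin L) : ℝ :=
  1 / (4 * (M.Le : ℝ) * ((M.Le : ℝ) + K.deltaR - K.deltaH / 2)) *
    ((L : ℝ) - ((p : ℝ) + 1) + K.deltaC / 2 + K.deltaR + K.deltaH / 4) * M.strength

end Model

end RandomPhase

end

/-! After conjugation with the Cayley transform, `P` in the Lie algebra has anti-Hermitian diagonal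
blocks, and its off-diagonal blocks are a matrix `B` (`coupling P`) and its adjoint. With `W = U* B
V` one gets `Φ*(P* + P)Φ = W + W*`, while the quadratic form in `G_p` is `2 U*BB*U + 2 V*B*BV` plus
a term `U*ZV` and its adjoint. At fixed `P` the average of the second order expression over the
geometric measure thus needs only second and fourth moments of the phases `U`, `V`.

Write `N = L_e · dim` for the complex size of the elliptic block. Terms without phase balance vanish
on average. The hyperbolic channels `q < p` remove from the quadratic term precisely the weight of
`B` that couples elliptic to hyperbolic channels, so that only `w`, the sum of `|B_ij|²` over
elliptic `i`, `j`, survives; `4w/dim` is the integrand of `T`. Each elliptic `q < p` then subtracts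
the same amount, which is why the spectrum is equidistant, and `q = p` produces the offset that
depends on the symmetry class.

The class enters only through the mean of `|W_ab|²`. For `ℂ`, independence of `U` and `V` gives
`w/N²`. For `ℝ` and `ℍ`, `V` is a twisted complex conjugate of `U`; then `W` is, up to sign and
conjugation, a quadratic form in `U` alone with a symmetric (`ℝ`, `s = 1`) or antisymmetric (`ℍ`, `s
= -1`) matrix, and the fourth Haar moments give `w(1 + s δ)/(N(N + s))`, with `δ = 1` exactly if `a`
is conjugate to `b`. These facts are `frame_form_add`, `frame_form_quadratic`,
`IsHaarUnitary.moment_quadratic`, `PhaseMoments.integral_density` and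
`Model.IsGeometric.integral_density`.

Finally, averaging over `P` leaves a gauge invariant polynomial in the frame, so the random phase
property replaces the invariant measure by the geometric one with error `O(λ²)`, which the prefactor
`λ²/4` turns into `O(λ⁴)`. -/

namespace RandomPhase

/-! ### Bounded random variables -/

section Bounded

variable {Ω : Type*} [MeasurableSpace Ω] {μ : Measure Ω}

lemma MemLp.mul_top {f g : Ω → ℂ} (hf : MemLp f ⊤ μ) (hg : MemLp g ⊤ μ) :
    MemLp (fun x => f x * g x) ⊤ μ :=
  MemLp.mul' (p := ⊤) (q := ⊤) hg hf

lemma MemLp.star_top {f : Ω → ℂ} (hf : MemLp f ⊤ μ) : MemLp (fun x => star (f x)) ⊤ μ :=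
  hf.star

lemma MemLp.integrable_top [IsFiniteMeasure μ] {f : Ω → ℂ} (hf : MemLp f ⊤ μ) :
    Integrable f μ :=
  hf.integrable le_top

/-- The common criterion behind all vanishing moments: an invariance that multiplies a moment by a
factor other than 1 kills it. -/
lemma eq_zero_of_eq_mul_self {c x : ℂ} (hc : c ≠ 1) (h : x = c * x) : x = 0 := by
  have : (1 - c) * x = 0 := by linear_combination h
  rcases mul_eq_zero.1 this with h | h
  · exact absurd (by linear_combination -h) hc
  · exact h

end Bounded

/-! ### Second and fourth moments of the Haar measure on the unitary group -/

section Haar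

lemma measurable_entry {m n : Type} (i : m) (j : n) :
    Measurable fun A : Matrix m n ℂ => A i j :=
  (measurable_pi_apply j).comp (measurable_pi_apply (X := fun _ : m => n → ℂ) i)

lemma measurable_matrix {Ω : Type*} [MeasurableSpace Ω] {m n : Type} {F : Ω → Matrix m n ℂ}
    (h : ∀ i j, Measurable fun x => F x i j) : Measurable F :=
  measurable_pi_iff.2 fun i => measurable_pi_iff.2 fun j => h i j

lemma measurable_mul_left {m n : Type} [Fintype n] (W : Matrix n n ℂ) :
    Measurable fun U : Matrix n m ℂ => W * U := by
  refine measurable_matrix fun i j => ?_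
  simp only [Matrix.mul_apply]
  exact Finset.measurable_sum _ fun k _ => (measurable_entry k j).const_mul _

variable {n : Type} [Fintype n] [DecidableEq n] {ρ : Measure (Matrix n n ℂ)}

/-- Left multiplication by a unitary matrix as a measurable equivalence. -/
noncomputable def unitaryMulEquiv (W : Matrix n n ℂ) (hW : W ∈ Matrix.unitaryGroup n ℂ) :
    Matrix n n ℂ ≃ᵐ Matrix n n ℂ where
  toFun U := W * U
  invFun U := star W * U
  left_inv U := by
    beta_reduce
    rw [← Matrix.mul_assoc, Matrix.mem_unitaryGroup_iff'.1 hW, Matrix.one_mul]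
  right_inv U := by
    beta_reduce
    rw [← Matrix.mul_assoc, Matrix.mem_unitaryGroup_iff.1 hW, Matrix.one_mul]
  measurable_toFun := measurable_mul_left W
  measurable_invFun := measurable_mul_left (star W)

/-- Because the translation is a measurable equivalence, nothing has to be assumed about `F`. All
moments below follow from three kinds of `W`: diagonal phases, permutations and one rational
reflection. -/
lemma IsHaarUnitary.integral_mul_left (h : IsHaarUnitary ρ) {W : Matrix n n ℂ}
    (hW : W ∈ Matrix.unitaryGroup n ℂ) (F : Matrix n n ℂ → ℂ) :
    ∫ U, F (W * U) ∂ρ = ∫ U, F U ∂ρ :=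
  MeasurePreserving.integral_comp' (f := unitaryMulEquiv W hW)
    ⟨measurable_mul_left W, h.2.2 W hW⟩ F

lemma IsHaarUnitary.memLp_entry (h : IsHaarUnitary ρ) (i a : n) :
    MemLp (fun U : Matrix n n ℂ => U i a) ⊤ ρ := by
  have := h.1
  refine memLp_top_of_bound (measurable_entry i a).aestronglyMeasurable 1 ?_
  filter_upwards [h.2.1] with U hU using entry_norm_bound_of_unitary hU i a

/-- Invariance under multiplication of each row by a phase. -/
lemma IsHaarUnitary.integral_phase (h : IsHaarUnitary ρ) {z : n → ℂ} (hz : ∀ i, star (z i) * z i = 1)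
    (F : Matrix n n ℂ → ℂ) :
    ∫ U, F (Matrix.of fun i a => z i * U i a) ∂ρ = ∫ U, F U ∂ρ := by
  have hW : Matrix.diagonal z ∈ Matrix.unitaryGroup n ℂ := by
    rw [Matrix.mem_unitaryGroup_iff', Matrix.star_eq_conjTranspose,
      Matrix.diagonal_conjTranspose, Matrix.diagonal_mul_diagonal]
    rw [← Matrix.diagonal_one]
    congr 1
    funext i
    exact hz i
  rw [← h.integral_mul_left hW F]
  congr 1
  funext U
  congr 1
  ext i a
  simp [Matrix.diagonal_mul]

/-- Invariance under permutations of the rows. -/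
lemma IsHaarUnitary.integral_perm (h : IsHaarUnitary ρ) (e : Equiv.Perm n)
    (F : Matrix n n ℂ → ℂ) :
    ∫ U, F (U.submatrix e id) ∂ρ = ∫ U, F U ∂ρ := by
  have hW : (1 : Matrix n n ℂ).submatrix e id ∈ Matrix.unitaryGroup n ℂ := by
    rw [Matrix.mem_unitaryGroup_iff, Matrix.star_eq_conjTranspose,
      Matrix.conjTranspose_submatrix, Matrix.conjTranspose_one]
    exact (Matrix.submatrix_mul_equiv _ _ e (Equiv.refl n) e).trans (by simp)
  rw [← h.integral_mul_left hW F]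
  congr 1
  funext U
  congr 1
  ext i a
  simp [Matrix.mul_apply, Matrix.one_apply]

/-- Invariance under the reflection mixing the rows `i` and `j` with weights `3/5`, `4/5`. -/
lemma IsHaarUnitary.integral_reflection (h : IsHaarUnitary ρ) {i j : n} (hij : i ≠ j)
    (F : (n → ℂ) → ℂ) :
    ∫ U : Matrix n n ℂ, F (fun a => (3 * U i a + 4 * U j a) / 5) ∂ρ = ∫ U : Matrix n n ℂ, F (U i) ∂ρ := by
  -- The reflection in the hyperplane orthogonal to `w = e_i - 2 e_j`; since `w · w = 5`, its row
  -- `i` is `(3/5, 4/5)`, so all weights are rational.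
  set w : n → ℂ := Pi.single i 1 - Pi.single j 2 with hw
  have hww : w ⬝ᵥ w = 5 := by
    simp [hw, dotProduct_sub, hij, hij.symm]; norm_num
  have hstar : star w = w := by
    funext k
    by_cases h1 : k = i <;> by_cases h2 : k = j <;> simp [hw, h1, h2, hij, hij.symm]
  have hW : (1 : Matrix n n ℂ) - (2 / 5 : ℂ) • Matrix.vecMulVec w w ∈ Matrix.unitaryGroup n ℂ := by
    have h1 : star ((1 : Matrix n n ℂ) - (2 / 5 : ℂ) • Matrix.vecMulVec w w)
        = 1 - (2 / 5 : ℂ) • Matrix.vecMulVec w w := by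
      rw [star_sub, star_smul, star_one, Matrix.star_eq_conjTranspose,
        Matrix.conjTranspose_vecMulVec, hstar]
      simp
    rw [Matrix.mem_unitaryGroup_iff', h1]
    have h2 : Matrix.vecMulVec w w * Matrix.vecMulVec w w = (5 : ℂ) • Matrix.vecMulVec w w := by
      rw [Matrix.vecMulVec_mul_vecMulVec, hww]
      ext k l
      simp [Matrix.vecMulVec_apply]; ring
    simp only [sub_mul, mul_sub, one_mul, mul_one, smul_mul_assoc, mul_smul_comm, h2]
    module
  rw [← h.integral_mul_left hW (fun U => F (U i))]
  congr 1
  funext U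
  congr 1
  funext a
  have : (Matrix.vecMulVec w w * U) i a = U i a - 2 * U j a := by
    simp only [Matrix.mul_apply, Matrix.vecMulVec_apply, mul_assoc, ← Finset.mul_sum]
    simp [hw, sub_mul, Finset.sum_sub_distrib, Pi.single_apply, hij]
  simp only [Matrix.sub_mul, Matrix.one_mul, Matrix.smul_mul, Matrix.sub_apply, Matrix.smul_apply,
    this, smul_eq_mul]
  ring

/-- The first moments of the Haar measure vanish. -/
lemma IsHaarUnitary.moment_one (h : IsHaarUnitary ρ) (i a : n) :
    ∫ U : Matrix n n ℂ, U i a ∂ρ = 0 := by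
  refine eq_zero_of_eq_mul_self (c := -1) (by norm_num) ?_
  rw [← integral_const_mul]
  conv_lhs => rw [← h.integral_phase (z := fun _ => -1) (by simp) (fun U => U i a)]
  simp

/-- Unbalanced second moments of the Haar measure vanish. -/
lemma IsHaarUnitary.moment_two_zero (h : IsHaarUnitary ρ) (i j a b : n) :
    ∫ U : Matrix n n ℂ, U i a * U j b ∂ρ = 0 := by
  refine eq_zero_of_eq_mul_self (c := -1) (by norm_num) ?_
  rw [← integral_const_mul]
  conv_lhs => rw [← h.integral_phase (z := fun _ => Complex.I) (by simp) (fun U => U i a * U j b)]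
  congr 1
  funext U
  simp only [Matrix.of_apply]
  linear_combination U i a * U j b * Complex.I_mul_I

/-- Unbalanced fourth moments of the Haar measure vanish. -/
lemma IsHaarUnitary.moment_four_zero (h : IsHaarUnitary ρ) (i j k l a b c d : n) :
    ∫ U : Matrix n n ℂ, U i a * U j b * (U k c * U l d) ∂ρ = 0 := by
  -- The global phase `z` multiplies a product of four unconjugated entries by `z ^ 4 = -1`.
  obtain ⟨z, hz⟩ := IsAlgClosed.exists_pow_nat_eq (-1 : ℂ) (n := 4) (by norm_num)
  have hz1 : ‖z‖ = 1 := by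
    have : ‖z‖ ^ 4 = 1 := by rw [← norm_pow, hz]; simp
    exact (pow_eq_one_iff_of_nonneg (norm_nonneg z) (by norm_num)).1 this
  refine eq_zero_of_eq_mul_self (c := -1) (by norm_num) ?_
  rw [← integral_const_mul]
  have hzz : star z * z = 1 := by
    have := Complex.conj_mul' z
    rw [hz1] at this
    simpa using this
  conv_lhs => rw [← h.integral_phase (z := fun _ => z) (fun _ => hzz)
    (fun U => U i a * U j b * (U k c * U l d))]
  congr 1
  funext U
  simp only [Matrix.of_apply]
  linear_combination U i a * U j b * (U k c * U l d) * hz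

lemma unitary_col_sum {U : Matrix n n ℂ} (hU : U ∈ Matrix.unitaryGroup n ℂ) (a b : n) :
    ∑ i, star (U i a) * U i b = if a = b then 1 else 0 := by
  have := congrFun (congrFun (Matrix.mem_unitaryGroup_iff'.1 hU) a) b
  simpa [Matrix.mul_apply, Matrix.one_apply] using this

/-- The second moments of the Haar measure of the unitary group. -/
lemma IsHaarUnitary.moment_two (h : IsHaarUnitary ρ) (i j a b : n) :
    ∫ U : Matrix n n ℂ, star (U i a) * U j b ∂ρ =
      if i = j ∧ a = b then (Fintype.card n : ℂ)⁻¹ else 0 := by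
  have := h.1
  by_cases hij : i = j
  · subst hij
    -- All rows contribute equally, and the sum over the rows is the entry of `U* U = 1`.
    have hperm : ∀ k, ∫ U : Matrix n n ℂ, star (U k a) * U k b ∂ρ
        = ∫ U : Matrix n n ℂ, star (U i a) * U i b ∂ρ := by
      intro k
      rw [← h.integral_perm (Equiv.swap i k) (fun U => star (U i a) * U i b)]
      simp
    have hsum : ∑ k, ∫ U : Matrix n n ℂ, star (U k a) * U k b ∂ρ = if a = b then 1 else 0 := by
      rw [← integral_finsetSum]
      · rw [integral_congr_ae (g := fun _ => if a = b then (1 : ℂ) else 0)]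
        · simp
        · filter_upwards [h.2.1] with U hU using unitary_col_sum hU a b
      · intro k _
        exact MemLp.integrable_top
          (MemLp.mul_top (MemLp.star_top (h.memLp_entry k a)) (h.memLp_entry k b))
    simp only [hperm, Finset.sum_const, Finset.card_univ, nsmul_eq_mul] at hsum
    have hN : (Fintype.card n : ℂ) ≠ 0 := by
      have : Nonempty n := ⟨i⟩
      exact_mod_cast Fintype.card_ne_zero
    have : ∫ U : Matrix n n ℂ, star (U i a) * U i b ∂ρ
        = (Fintype.card n : ℂ)⁻¹ * if a = b then 1 else 0 := by
      rw [← hsum, inv_mul_cancel_left₀ hN]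
    rw [this]
    by_cases hab : a = b <;> simp [hab]
  · rw [if_neg (fun hh => hij hh.1)]
    refine eq_zero_of_eq_mul_self (c := -1) (by norm_num) ?_
    rw [← integral_const_mul]
    conv_lhs => rw [← h.integral_phase (z := fun k => if k = j then -1 else 1)
      (by intro k; split_ifs <;> simp) (fun U => star (U i a) * U j b)]
    simp [hij]

/-- The balanced fourth moment of the columns `a` and `b`. -/
noncomputable def moment4 (ρ : Measure (Matrix n n ℂ)) (a b i j k l : n) : ℂ :=
  ∫ U : Matrix n n ℂ, star (U i a * U j b) * (U k a * U l b) ∂ρ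

lemma IsHaarUnitary.integrable_moment4 (h : IsHaarUnitary ρ) (a b i j k l : n) :
    Integrable (fun U : Matrix n n ℂ => star (U i a * U j b) * (U k a * U l b)) ρ := by
  have := h.1
  exact MemLp.integrable_top (MemLp.mul_top (MemLp.star_top
    (MemLp.mul_top (h.memLp_entry i a) (h.memLp_entry j b)))
    (MemLp.mul_top (h.memLp_entry k a) (h.memLp_entry l b)))

lemma IsHaarUnitary.moment4_perm (h : IsHaarUnitary ρ) (e : Equiv.Perm n) (a b i j k l : n) :
    moment4 ρ a b (e i) (e j) (e k) (e l) = moment4 ρ a b i j k l := by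
  unfold moment4
  rw [← h.integral_perm e (fun U => star (U i a * U j b) * (U k a * U l b))]
  simp

/-- Row `m` is multiplied by the imaginary unit. Unlike a sign, this factor also detects a row that
occurs twice unconjugated and never conjugated. -/
lemma IsHaarUnitary.moment4_phase (h : IsHaarUnitary ρ) (m a b i j k l : n)
    (hm : star ((if i = m then Complex.I else 1) * (if j = m then Complex.I else 1)) *
      ((if k = m then Complex.I else 1) * (if l = m then Complex.I else 1)) ≠ 1) :
    moment4 ρ a b i j k l = 0 := by
  refine eq_zero_of_eq_mul_self hm ?_
  unfold moment4
  rw [← integral_const_mul]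
  conv_lhs => rw [← h.integral_phase (z := fun k => if k = m then Complex.I else 1)
    (by intro k; split_ifs <;> simp) (fun U => star (U i a * U j b) * (U k a * U l b))]
  congr 1
  funext U
  simp only [Matrix.of_apply, star_mul']
  ring

/-- If the row pairs `{i, j}` and `{k, l}` differ as multisets, some row among `k`, `l` is
unbalanced, and a phase in that row makes the moment vanish. -/
lemma IsHaarUnitary.moment4_eq_zero (h : IsHaarUnitary ρ) (a b i j k l : n)
    (h1 : ¬(k = i ∧ l = j)) (h2 : ¬(k = j ∧ l = i)) : moment4 ρ a b i j k l = 0 := by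
  have hI1 : Complex.I ≠ 1 := fun hh => by simpa using congrArg Complex.re hh
  have hI2 : (-1 : ℂ) ≠ 1 := by norm_num
  by_cases hki : k = i
  · subst hki
    refine h.moment4_phase l a b _ _ _ _ ?_
    have hlj : j ≠ l := fun hh => h1 ⟨rfl, hh.symm⟩
    by_cases hkl : k = l <;> simp [hkl, hlj, hI1]
  · by_cases hkj : k = j
    · subst hkj
      refine h.moment4_phase l a b _ _ _ _ ?_
      have hlj : i ≠ l := fun hh => h2 ⟨rfl, hh.symm⟩
      by_cases hkl : k = l <;> simp [hkl, hlj, hI1]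
    · refine h.moment4_phase k a b _ _ _ _ ?_
      have hik : i ≠ k := Ne.symm hki
      have hjk : j ≠ k := Ne.symm hkj
      by_cases hkl : l = k <;> simp [hkl, hik, hjk, hI1, hI2]

/-- Phases and permutations cannot relate the moment with four equal rows to the two pairings; a
rotation that mixes two rows can. Expanding the invariance under the `3-4-5` reflection and dropping
unbalanced terms leaves one linear equation. -/
lemma IsHaarUnitary.moment4_diag (h : IsHaarUnitary ρ) (a b : n) {i j : n} (hij : i ≠ j) :
    moment4 ρ a b i i i i = moment4 ρ a b i j i j + moment4 ρ a b i j j i := by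
  have hsw : ∀ p q r s, moment4 ρ a b (Equiv.swap i j p) (Equiv.swap i j q) (Equiv.swap i j r)
      (Equiv.swap i j s) = moment4 ρ a b p q r s := fun p q r s => h.moment4_perm _ a b p q r s
  have e1 : moment4 ρ a b j j j j = moment4 ρ a b i i i i := by simpa using hsw i i i i
  have e2 : moment4 ρ a b j i j i = moment4 ρ a b i j i j := by simpa using hsw i j i j
  have e3 : moment4 ρ a b j i i j = moment4 ρ a b i j j i := by simpa using hsw i j j i
  -- Each of the four factors selects row `i` with weight 3 or row `j` with weight 4, encoded by a
  -- Boolean; the denominator is `5 ^ 4 = 625`.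
  have key : moment4 ρ a b i i i i =
      ∑ p : Bool, ∑ q : Bool, ∑ r : Bool, ∑ s : Bool,
        (cond p 3 4 * cond q 3 4 * (cond r 3 4 * cond s 3 4) / 625 : ℂ) *
          moment4 ρ a b (cond p i j) (cond q i j) (cond r i j) (cond s i j) := by
    conv_lhs => unfold moment4
    rw [← h.integral_reflection hij (fun f => star (f a * f b) * (f a * f b))]
    unfold moment4
    simp only [← integral_const_mul]
    simp only [← Fintype.sum_prod_type']
    rw [← integral_finsetSum]
    · congr 1
      funext U
      simp only [Fintype.sum_prod_type, Fintype.sum_bool, cond_true, cond_false, star_mul',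
        star_div₀, star_add, star_ofNat]
      ring
    · intro x _
      exact (h.integrable_moment4 _ _ _ _ _ _).const_mul _
  have hji := hij.symm
  have z1 := h.moment4_eq_zero a b i i i j (by simp [hji]) (by simp [hji])
  have z2 := h.moment4_eq_zero a b i i j i (by simp [hji]) (by simp [hji])
  have z3 := h.moment4_eq_zero a b i i j j (by simp [hji]) (by simp [hji])
  have z4 := h.moment4_eq_zero a b i j i i (by simp [hij]) (by simp [hij])
  have z5 := h.moment4_eq_zero a b i j j j (by simp [hji]) (by simp [hji])
  have z6 := h.moment4_eq_zero a b j i i i (by simp [hij]) (by simp [hij])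
  have z7 := h.moment4_eq_zero a b j i j j (by simp [hji]) (by simp [hji])
  have z8 := h.moment4_eq_zero a b j j i i (by simp [hij]) (by simp [hij])
  have z9 := h.moment4_eq_zero a b j j i j (by simp [hij]) (by simp [hij])
  have z10 := h.moment4_eq_zero a b j j j i (by simp [hij]) (by simp [hij])
  simp only [Fintype.sum_bool, cond_true, cond_false, z1, z2, z3, z4, z5, z6, z7, z8, z9, z10,
    e1, e2, e3] at key
  -- The diagonal term has weight `3 ^ 4 + 4 ^ 4 = 337` and each pairing `2 · 144 = 288`; also `625
  -- - 337 = 288`.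
  linear_combination (625 / 288 : ℂ) * key

/-- The balanced fourth moments are combinations of the two pairings. -/
lemma IsHaarUnitary.exists_moment4 (h : IsHaarUnitary ρ) (a b : n) : ∃ x y : ℂ, ∀ i j k l,
    moment4 ρ a b i j k l =
      (if k = i ∧ l = j then x else 0) + (if k = j ∧ l = i then y else 0) := by
  by_cases hn : ∃ i j : n, i ≠ j
  · obtain ⟨i₀, j₀, h0⟩ := hn
    refine ⟨moment4 ρ a b i₀ j₀ i₀ j₀, moment4 ρ a b i₀ j₀ j₀ i₀, fun i j k l => ?_⟩
    have hperm : ∀ i j : n, i ≠ j → ∃ e : Equiv.Perm n, e i₀ = i ∧ e j₀ = j := by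
      intro i j hij
      -- The first swap moves `i₀` to `i`; the second moves the image of `j₀` to `j` and leaves `i`
      -- alone.
      refine ⟨(Equiv.swap i₀ i).trans (Equiv.swap (Equiv.swap i₀ i j₀) j), ?_, ?_⟩
      · rw [Equiv.trans_apply, Equiv.swap_apply_left]
        refine Equiv.swap_apply_of_ne_of_ne ?_ hij
        intro hh
        have : Equiv.swap i₀ i i₀ = Equiv.swap i₀ i j₀ := by
          rw [Equiv.swap_apply_left]; exact hh
        exact h0 ((Equiv.swap i₀ i).injective this)
      · rw [Equiv.trans_apply, Equiv.swap_apply_left]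
    by_cases hij : i = j
    · subst hij
      by_cases hk : k = i ∧ l = i
      · obtain ⟨rfl, rfl⟩ := hk
        have h1 : ∀ k, moment4 ρ a b k k k k = moment4 ρ a b i₀ i₀ i₀ i₀ := by
          intro k
          have := h.moment4_perm (Equiv.swap i₀ k) a b i₀ i₀ i₀ i₀
          simpa using this
        simp [h1, h.moment4_diag a b h0]
      · rw [h.moment4_eq_zero a b i i k l hk hk]
        simp [hk]
    · obtain ⟨e, rfl, rfl⟩ := hperm i j hij
      by_cases hk : k = e i₀ ∧ l = e j₀
      · obtain ⟨rfl, rfl⟩ := hk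
        rw [h.moment4_perm]
        simp [h0]
      · by_cases hk' : k = e j₀ ∧ l = e i₀
        · obtain ⟨rfl, rfl⟩ := hk'
          rw [h.moment4_perm]
          simp [Ne.symm h0]
        · rw [h.moment4_eq_zero a b _ _ k l hk hk']
          simp [hk, hk']
  · push Not at hn
    -- With a single index both pairings coincide, and the split into `x` and `y` is arbitrary.
    refine ⟨moment4 ρ a b a a a a, 0, fun i j k l => ?_⟩
    simp [hn i a, hn j a, hn k a, hn l a]

/-- Second moments of `U* M Ū` for a symmetric (`s = 1`) or antisymmetric (`s = -1`)
matrix `M`. -/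
lemma IsHaarUnitary.moment_quadratic (h : IsHaarUnitary ρ) (a b : n) (s : ℂ) (hs : s * s = 1)
    (M : Matrix n n ℂ) (hM : ∀ i j, M j i = s * M i j) :
    ((Fintype.card n : ℂ) + s) * ∫ U : Matrix n n ℂ,
      star (∑ i, ∑ j, star (M i j) * (U i a * U j b)) *
        (∑ i, ∑ j, star (M i j) * (U i a * U j b)) ∂ρ =
      (Fintype.card n : ℂ)⁻¹ * (1 + s * if a = b then 1 else 0) * ∑ i, ∑ j, M i j * star (M i j) := by
  have := h.1
  obtain ⟨x, y, hxy⟩ := h.exists_moment4 a b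
  have hN : (Fintype.card n : ℂ) ≠ 0 := by
    have : Nonempty n := ⟨a⟩
    exact_mod_cast Fintype.card_ne_zero
  -- Contracting one pair of rows by `U* U = 1` reduces a fourth moment to a second one. The two
  -- possible contractions give two linear equations for `x` and `y`.
  have h1 : (Fintype.card n : ℂ) * x + y = (Fintype.card n : ℂ)⁻¹ := by
    have e1 : ∑ j, moment4 ρ a b a j a j = (Fintype.card n : ℂ) * x + y := by
      have hc : ∀ j : n, (a = j ∧ j = a) ↔ j = a := fun j =>
        ⟨fun hh => hh.2, fun hh => ⟨hh.symm, hh⟩⟩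
      simp [hxy, Finset.sum_add_distrib, hc]
    rw [← e1]
    unfold moment4
    rw [← integral_finsetSum _ fun j _ => h.integrable_moment4 _ _ _ _ _ _]
    have := h.moment_two a a a a
    rw [if_pos ⟨rfl, rfl⟩] at this
    rw [← this]
    refine integral_congr_ae ?_
    filter_upwards [h.2.1] with U hU
    have hsum := unitary_col_sum hU b b
    rw [if_pos rfl] at hsum
    calc _ = star (U a a) * U a a * ∑ j, star (U j b) * U j b := by
          rw [Finset.mul_sum]; refine Finset.sum_congr rfl fun j _ => ?_
          rw [star_mul']; ring
      _ = _ := by rw [hsum, mul_one]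
  have h2 : x + (Fintype.card n : ℂ) * y = (Fintype.card n : ℂ)⁻¹ * if a = b then 1 else 0 := by
    have e1 : ∑ j, moment4 ρ a b a j j a = x + (Fintype.card n : ℂ) * y := by
      have hc : ∀ j : n, (j = a ∧ a = j) ↔ j = a := fun j =>
        ⟨fun hh => hh.1, fun hh => ⟨hh, hh.symm⟩⟩
      simp [hxy, Finset.sum_add_distrib, hc]
    rw [← e1]
    unfold moment4
    rw [← integral_finsetSum _ fun j _ => h.integrable_moment4 _ _ _ _ _ _]
    have := h.moment_two a a a b
    have e2 : (Fintype.card n : ℂ)⁻¹ * (if a = b then 1 else 0) =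
      (if a = b then 1 else 0) * ∫ U : Matrix n n ℂ, star (U a a) * U a b ∂ρ := by
      rw [this]; by_cases hab : a = b <;> simp [hab]
    rw [e2, ← integral_const_mul]
    refine integral_congr_ae ?_
    filter_upwards [h.2.1] with U hU
    have hsum := unitary_col_sum hU b a
    calc _ = star (U a a) * U a b * ∑ j, star (U j b) * U j a := by
          rw [Finset.mul_sum]; refine Finset.sum_congr rfl fun j _ => ?_
          rw [star_mul']; ring
      _ = _ := by
        rw [hsum]
        by_cases hab : a = b
        · simp [hab]
        · simp [hab, Ne.symm hab]
  -- The direct pairing reproduces the Hilbert-Schmidt norm of `M`; the crossed pairing transposes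
  -- `M`, which costs the factor `s`.
  have hI : ∫ U : Matrix n n ℂ,
      star (∑ i, ∑ j, star (M i j) * (U i a * U j b)) *
        (∑ i, ∑ j, star (M i j) * (U i a * U j b)) ∂ρ
      = (x + s * y) * ∑ i, ∑ j, M i j * star (M i j) := by
    have e1 : ∀ U : Matrix n n ℂ, star (∑ i, ∑ j, star (M i j) * (U i a * U j b)) *
        (∑ i, ∑ j, star (M i j) * (U i a * U j b)) =
        ∑ p : n × n × n × n, (M p.1 p.2.1 * star (M p.2.2.1 p.2.2.2)) *
          (star (U p.1 a * U p.2.1 b) * (U p.2.2.1 a * U p.2.2.2 b)) := by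
      intro U
      simp only [Fintype.sum_prod_type, star_sum, Finset.sum_mul]
      refine Finset.sum_congr rfl fun i _ => Finset.sum_congr rfl fun j _ => ?_
      simp only [Finset.mul_sum]
      refine Finset.sum_congr rfl fun k _ => Finset.sum_congr rfl fun l _ => ?_
      simp only [star_mul', star_star]; ring
    simp only [e1]
    rw [integral_finsetSum _ fun p _ => (h.integrable_moment4 _ _ _ _ _ _).const_mul _]
    simp only [integral_const_mul]
    have e2 : ∀ p : n × n × n × n, ∫ U : Matrix n n ℂ,
        (star (U p.1 a * U p.2.1 b) * (U p.2.2.1 a * U p.2.2.2 b)) ∂ρ =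
        moment4 ρ a b p.1 p.2.1 p.2.2.1 p.2.2.2 := fun p => rfl
    simp only [e2, hxy, Fintype.sum_prod_type, mul_add, Finset.sum_add_distrib, mul_ite, mul_zero]
    have e3 : ∀ i j : n, ∑ k, ∑ l, (if k = i ∧ l = j then M i j * star (M k l) * x else 0)
        = x * (M i j * star (M i j)) := by
      intro i j
      simp only [ite_and]
      simp [mul_comm]
    have e4 : ∀ i j : n, ∑ k, ∑ l, (if k = j ∧ l = i then M i j * star (M k l) * y else 0)
        = s * y * (M i j * star (M i j)) := by
      intro i j
      have hss : star s = s := by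
        have : s = 1 ∨ s = -1 := by
          have : (s - 1) * (s + 1) = 0 := by linear_combination hs
          rcases mul_eq_zero.1 this with h | h
          · left; linear_combination h
          · right; linear_combination h
        rcases this with rfl | rfl <;> simp
      simp only [ite_and]
      rw [Finset.sum_eq_single j (by intro k _ hk; simp [hk]) (by simp)]
      simp only [if_true, Finset.sum_ite_eq', Finset.mem_univ]
      rw [hM i j, star_mul', hss]
      ring
    simp only [e3, e4, ← Finset.mul_sum]
    ring
  rw [hI]
  -- Since `s * s = 1`, `(N + s)(x + s y) = (N x + y) + s (x + N y)`. The system is never solved for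
  -- `x` and `y` separately, so the degenerate case `N = 1` needs no exception.
  linear_combination (h1 + s * h2 + y * hs) * ∑ i, ∑ j, M i j * star (M i j)

end Haar

end RandomPhase

namespace RandomPhase

variable {K : SymClass} {L : ℕ}

/-! ### Frames and Lie algebra elements in the Cayley picture -/

section FrameAlgebra

lemma sqrt_two_mul_inv : ((Real.sqrt 2 : ℝ) : ℂ) * ((Real.sqrt 2 : ℝ) : ℂ)⁻¹ = 1 := by
  refine mul_inv_cancel₀ ?_
  simp

lemma phaseU_eq (Φ : FMat K L) : phaseU Φ = Φ.toRows₁ - Complex.I • Φ.toRows₂ := by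
  conv_lhs => rw [phaseU, cayley, ← Matrix.fromRows_toRows Φ]
  rw [Matrix.smul_mul, Matrix.fromBlocks_mul_fromRows]
  ext i j
  simp only [Matrix.smul_apply, Matrix.toRows₁_apply, Matrix.fromRows_apply_inl, smul_eq_mul,
    ← mul_assoc, sqrt_two_mul_inv]
  simp [sub_eq_add_neg]

lemma phaseV_eq (Φ : FMat K L) : phaseV Φ = Φ.toRows₁ + Complex.I • Φ.toRows₂ := by
  conv_lhs => rw [phaseV, cayley, ← Matrix.fromRows_toRows Φ]
  rw [Matrix.smul_mul, Matrix.fromBlocks_mul_fromRows]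
  ext i j
  simp only [Matrix.smul_apply, Matrix.toRows₂_apply, Matrix.fromRows_apply_inr, smul_eq_mul,
    ← mul_assoc, sqrt_two_mul_inv]
  simp

lemma IsFrame.blocks {Φ : FMat K L} (h : IsFrame Φ) :
    Φ.toRows₁ᴴ * Φ.toRows₁ + Φ.toRows₂ᴴ * Φ.toRows₂ = 1 ∧
      Φ.toRows₁ᴴ * Φ.toRows₂ = Φ.toRows₂ᴴ * Φ.toRows₁ := by
  obtain ⟨-, -, h1, h2⟩ := h
  rw [← Matrix.fromRows_toRows Φ] at h1 h2
  rw [Matrix.conjTranspose_fromRows_eq_fromCols_conjTranspose, Matrix.fromCols_mul_fromRows] at h1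
  rw [Matrix.conjTranspose_fromRows_eq_fromCols_conjTranspose, symJ, Matrix.J,
    Matrix.fromCols_mul_fromBlocks, Matrix.fromCols_mul_fromRows] at h2
  refine ⟨h1, ?_⟩
  simp only [mul_zero, zero_add, mul_one, mul_neg, add_zero, Matrix.neg_mul] at h2
  exact (sub_eq_zero.1 (by rw [sub_eq_add_neg]; exact h2)).symm

lemma IsFrame.phaseU_mem {Φ : FMat K L} (h : IsFrame Φ) :
    phaseU Φ ∈ Matrix.unitaryGroup (Ix K L) ℂ := by
  obtain ⟨h1, h2⟩ := h.blocks
  rw [Matrix.mem_unitaryGroup_iff', Matrix.star_eq_conjTranspose, phaseU_eq]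
  simp only [Matrix.conjTranspose_sub, Matrix.conjTranspose_smul, Complex.star_def,
    Complex.conj_I, sub_mul, mul_sub, smul_mul_assoc, mul_smul_comm, h2]
  rw [← h1]
  match_scalars <;> simp

lemma IsFrame.phaseV_mem {Φ : FMat K L} (h : IsFrame Φ) :
    phaseV Φ ∈ Matrix.unitaryGroup (Ix K L) ℂ := by
  obtain ⟨h1, h2⟩ := h.blocks
  rw [Matrix.mem_unitaryGroup_iff', Matrix.star_eq_conjTranspose, phaseV_eq]
  simp only [Matrix.conjTranspose_add, Matrix.conjTranspose_smul, Complex.star_def,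
    Complex.conj_I, add_mul, mul_add, smul_mul_assoc, mul_smul_comm, h2]
  rw [← h1]
  match_scalars <;> simp

lemma IsHS.blocks {P : BMat K L} (h : IsHS P) :
    P.toBlocks₂₂ = -P.toBlocks₁₁ᴴ ∧ P.toBlocks₁₂ᴴ = P.toBlocks₁₂ ∧
      P.toBlocks₂₁ᴴ = P.toBlocks₂₁ := by
  have h2 := h.2
  rw [← Matrix.fromBlocks_toBlocks P, Matrix.fromBlocks_conjTranspose, symJ, Matrix.J,
    Matrix.fromBlocks_multiply, Matrix.fromBlocks_multiply, Matrix.fromBlocks_add,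
    ← Matrix.fromBlocks_zero, Matrix.fromBlocks_inj] at h2
  simp only [mul_zero, mul_one, zero_add,
    zero_mul, neg_mul, one_mul, mul_neg, add_zero] at h2
  obtain ⟨h11, h12, h21, h22⟩ := h2
  refine ⟨?_, ?_, ?_⟩
  · have := neg_eq_zero.2 h12
    rw [eq_neg_iff_add_eq_zero, ← this]
    abel
  · exact (sub_eq_zero.1 (by rw [← neg_eq_zero, ← h22]; abel))
  · exact (sub_eq_zero.1 (by rw [← h11]; abel))

/-- The upper right block of `𝒞 P 𝒞*` for `P ∈ hs(2L, 𝕂)`. -/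
noncomputable def coupling (P : BMat K L) : SMat K L :=
  (1 / 2 : ℂ) • ((P.toBlocks₁₁ + P.toBlocks₁₁ᴴ) -
    Complex.I • (P.toBlocks₁₂ + P.toBlocks₂₁))

/-- The matrix `U* B V` which describes the action of `P` on the frame `Φ`. -/
noncomputable def reflection (P : BMat K L) (Φ : FMat K L) : SMat K L :=
  (phaseU Φ)ᴴ * coupling P * phaseV Φ

/-- This and `phaseV_mul` are the two block rows of `𝒞 P 𝒞*` acting on the pair `(U, V)`. -/
lemma phaseU_mul {P : BMat K L} (h : IsHS P) (Φ : FMat K L) :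
    phaseU (P * Φ) = (1 / 2 : ℂ) • (P.toBlocks₁₁ - P.toBlocks₁₁ᴴ +
      Complex.I • (P.toBlocks₁₂ - P.toBlocks₂₁)) * phaseU Φ + coupling P * phaseV Φ := by
  obtain ⟨h1, -, -⟩ := h.blocks
  unfold coupling
  rw [phaseU_eq, phaseU_eq, phaseV_eq]
  conv_lhs => rw [← Matrix.fromRows_toRows Φ, ← Matrix.fromBlocks_toBlocks P, h1,
    Matrix.fromBlocks_mul_fromRows, Matrix.toRows₁_fromRows, Matrix.toRows₂_fromRows]
  simp only [sub_mul, mul_sub, add_mul, mul_add, neg_mul, smul_mul_assoc, mul_smul_comm]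
  match_scalars <;> (ring_nf; try simp)

lemma phaseV_mul {P : BMat K L} (h : IsHS P) (Φ : FMat K L) :
    phaseV (P * Φ) = (coupling P)ᴴ * phaseU Φ + (1 / 2 : ℂ) • (P.toBlocks₁₁ - P.toBlocks₁₁ᴴ -
      Complex.I • (P.toBlocks₁₂ - P.toBlocks₂₁)) * phaseV Φ := by
  obtain ⟨h1, h2, h3⟩ := h.blocks
  unfold coupling
  rw [phaseV_eq, phaseU_eq, phaseV_eq]
  conv_lhs => rw [← Matrix.fromRows_toRows Φ, ← Matrix.fromBlocks_toBlocks P, h1,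
    Matrix.fromBlocks_mul_fromRows, Matrix.toRows₁_fromRows, Matrix.toRows₂_fromRows]
  simp only [Matrix.conjTranspose_sub, Matrix.conjTranspose_add, Matrix.conjTranspose_smul,
    Matrix.conjTranspose_conjTranspose, Complex.star_def, Complex.conj_I, h2, h3,
    map_div₀, map_one, map_ofNat, sub_mul, mul_sub, add_mul, mul_add, neg_mul, smul_mul_assoc,
    mul_smul_comm]
  match_scalars <;> (ring_nf; try simp)

/-- The diagonal blocks of `𝒞 P 𝒞*` are anti-Hermitian and cancel in `P* + P`. Two different
matrices are allowed so that `Ψ = P Φ`, which need not be a frame, can be inserted later. -/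
lemma frame_form_add' {P : BMat K L} (h : IsHS P) (Φ Ψ : FMat K L) :
    Φᴴ * (Pᴴ + P) * Ψ = (phaseU Φ)ᴴ * coupling P * phaseV Ψ +
      (phaseV Φ)ᴴ * (coupling P)ᴴ * phaseU Ψ := by
  obtain ⟨h1, h2, h3⟩ := h.blocks
  unfold coupling
  rw [phaseU_eq, phaseV_eq, phaseU_eq, phaseV_eq]
  conv_lhs => rw [← Matrix.fromRows_toRows Φ, ← Matrix.fromRows_toRows Ψ,
    ← Matrix.fromBlocks_toBlocks P,
    h1, Matrix.fromBlocks_conjTranspose, Matrix.fromBlocks_add,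
    Matrix.conjTranspose_fromRows_eq_fromCols_conjTranspose, Matrix.fromCols_mul_fromBlocks,
    Matrix.fromCols_mul_fromRows]
  simp only [Matrix.conjTranspose_sub, Matrix.conjTranspose_add, Matrix.conjTranspose_neg,
    Matrix.conjTranspose_smul, Matrix.conjTranspose_conjTranspose,
    Complex.star_def, Complex.conj_I, h2, h3, sub_mul, mul_sub, add_mul, mul_add, neg_mul, mul_neg,
    smul_mul_assoc, mul_smul_comm, map_div₀, map_one, map_ofNat]
  match_scalars <;> (ring_nf; try simp)

lemma frame_form_add {P : BMat K L} (h : IsHS P) (Φ : FMat K L) :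
    Φᴴ * (Pᴴ + P) * Φ = reflection P Φ + (reflection P Φ)ᴴ := by
  rw [frame_form_add' h, reflection]
  simp [Matrix.conjTranspose_mul, Matrix.mul_assoc]

/-- The form is `(P* + P) P` plus its adjoint, so the previous bilinear identity applies with `P Φ`
on the right. It matters that `Z` is independent of `Φ`: the cross term is then linear in the mixed
second moments of `U` and `V`. -/
lemma frame_form_quadratic {P : BMat K L} (h : IsHS P) :
    ∃ Z : SMat K L, ∀ Φ : FMat K L,
    Φᴴ * ((2 : ℂ) • (Pᴴ * P) + P * P + Pᴴ * Pᴴ) * Φ =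
      (2 : ℂ) • ((phaseU Φ)ᴴ * (coupling P * (coupling P)ᴴ) * phaseU Φ) +
      (2 : ℂ) • ((phaseV Φ)ᴴ * ((coupling P)ᴴ * coupling P) * phaseV Φ) +
      ((phaseU Φ)ᴴ * Z * phaseV Φ + ((phaseU Φ)ᴴ * Z * phaseV Φ)ᴴ) := by
  obtain ⟨A, hA⟩ : ∃ A, ∀ Φ, phaseU (P * Φ) = A * phaseU Φ + coupling P * phaseV Φ :=
    ⟨_, phaseU_mul h⟩
  obtain ⟨D, hD⟩ : ∃ D, ∀ Φ, phaseV (P * Φ) = (coupling P)ᴴ * phaseU Φ + D * phaseV Φ :=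
    ⟨_, phaseV_mul h⟩
  -- `A` and `D` are the diagonal blocks of `𝒞 P 𝒞*`; the second summand comes from the adjoint of
  -- `V* B* A U`.
  refine ⟨coupling P * D + Aᴴ * coupling P, fun Φ => ?_⟩
  have e1 : Φᴴ * ((2 : ℂ) • (Pᴴ * P) + P * P + Pᴴ * Pᴴ) * Φ =
      Φᴴ * (Pᴴ + P) * (P * Φ) + (Φᴴ * (Pᴴ + P) * (P * Φ))ᴴ := by
    simp only [Matrix.conjTranspose_mul, Matrix.conjTranspose_add,
      Matrix.conjTranspose_conjTranspose, Matrix.mul_assoc, Matrix.mul_add, Matrix.add_mul,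
      Matrix.smul_mul, Matrix.mul_smul]
    module
  rw [e1, frame_form_add' h, hA, hD]
  simp only [Matrix.conjTranspose_mul, Matrix.conjTranspose_add,
    Matrix.conjTranspose_conjTranspose, Matrix.mul_assoc, Matrix.mul_add, Matrix.add_mul]
  module

end FrameAlgebra

end RandomPhase

namespace RandomPhase

variable {K : SymClass} {L : ℕ}

/-! ### Elliptic weight and disorder strength -/

namespace Model

variable (M : Model K L)

/-- The indicator function of the elliptic indices. -/
noncomputable def ind (i : Ix K L) : ℂ := if M.Lh ≤ i.1.1 then 1 else 0

lemma ind_of_le {i : Ix K L} (h : M.Lh ≤ i.1.1) : M.ind i = 1 := if_pos h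

lemma ind_of_not_le {i : Ix K L} (h : ¬M.Lh ≤ i.1.1) : M.ind i = 0 := if_neg h

lemma ind_mul_self (i : Ix K L) : M.ind i * M.ind i = M.ind i := by
  unfold ind; split_ifs <;> simp

lemma piE_eq : M.piE = Matrix.diagonal M.ind := by
  unfold piE rdiag ind
  congr 1
  funext i
  split_ifs with h <;> simp [h]

lemma piE_mul_self : M.piE * M.piE = M.piE := by
  rw [piE_eq, Matrix.diagonal_mul_diagonal]
  congr 1
  funext i
  exact M.ind_mul_self i

/-- The squared Hilbert-Schmidt norm of the elliptic block of `B`. -/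
noncomputable def ellWeight (B : SMat K L) : ℂ :=
  ∑ i, ∑ j, M.ind i * M.ind j * (B i j * star (B i j))

lemma trace_ellWeight (B : SMat K L) :
    (M.piE * B * M.piE * Bᴴ * M.piE).trace = M.ellWeight B := by
  rw [Matrix.trace_mul_comm, ← Matrix.mul_assoc, ← Matrix.mul_assoc, ← Matrix.mul_assoc,
    M.piE_mul_self, piE_eq, ellWeight, Matrix.trace]
  refine Finset.sum_congr rfl fun i _ => ?_
  rw [Matrix.diag_apply, Matrix.mul_apply]
  refine Finset.sum_congr rfl fun j _ => ?_
  rw [Matrix.mul_diagonal, Matrix.diagonal_mul, Matrix.conjTranspose_apply]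
  ring

lemma trace_fromBlocks (A B C D : SMat K L) :
    (Matrix.fromBlocks A B C D).trace = A.trace + D.trace := by
  simp [Matrix.trace, Fintype.sum_sum_type]

/-- `Π_e` commutes with the Cayley transform, so only the elliptic parts of `B` and `B*` enter. This
identifies the one quantity that survives the phase average with the integrand of `T`. -/
lemma strength_integrand {P : BMat K L} (h : IsHS P) :
    trK K (M.PiE * (Pᴴ + P) * M.PiE * P * M.PiE) =
      (K.dim : ℂ)⁻¹ * (4 * M.ellWeight (coupling P)) := by
  obtain ⟨h1, h2, h3⟩ := h.blocks
  rw [trK, ← trace_ellWeight]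
  congr 1
  unfold coupling PiE
  conv_lhs => rw [← Matrix.fromBlocks_toBlocks P, h1, Matrix.fromBlocks_conjTranspose,
    Matrix.fromBlocks_add, Matrix.fromBlocks_multiply, Matrix.fromBlocks_multiply,
    Matrix.fromBlocks_multiply, Matrix.fromBlocks_multiply, trace_fromBlocks]
  simp only [Matrix.conjTranspose_sub, Matrix.conjTranspose_add, Matrix.conjTranspose_neg,
    Matrix.conjTranspose_smul, Matrix.conjTranspose_conjTranspose,
    Complex.star_def, Complex.conj_I, h2, h3, sub_mul, mul_sub, add_mul, mul_add, neg_mul, mul_neg,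
    smul_mul_assoc, mul_smul_comm, map_div₀, map_one, map_ofNat, mul_zero, zero_mul, add_zero,
    zero_add, Matrix.trace_add, Matrix.trace_sub, Matrix.trace_neg, Matrix.trace_smul]
  have hcomm : ∀ X Y : SMat K L, (M.piE * X * M.piE * Y * M.piE).trace =
      (M.piE * Y * M.piE * X * M.piE).trace := by
    intro X Y
    calc (M.piE * X * M.piE * Y * M.piE).trace
        = ((M.piE * X * M.piE) * (M.piE * Y * M.piE)).trace := by
          rw [← Matrix.mul_assoc, ← Matrix.mul_assoc, Matrix.mul_assoc _ M.piE M.piE,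
            M.piE_mul_self]
      _ = ((M.piE * Y * M.piE) * (M.piE * X * M.piE)).trace := Matrix.trace_mul_comm _ _
      _ = _ := by
          rw [← Matrix.mul_assoc, ← Matrix.mul_assoc, Matrix.mul_assoc _ M.piE M.piE,
            M.piE_mul_self]
  rw [hcomm P.toBlocks₁₂ P.toBlocks₁₁, hcomm P.toBlocks₂₁ P.toBlocks₁₁,
    hcomm P.toBlocks₁₂ P.toBlocks₁₁ᴴ, hcomm P.toBlocks₂₁ P.toBlocks₁₁ᴴ,
    hcomm P.toBlocks₁₁ᴴ P.toBlocks₁₁, hcomm P.toBlocks₂₁ P.toBlocks₁₂]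
  simp only [smul_eq_mul, Matrix.trace_zero]
  ring_nf
  simp only [Complex.I_sq]
  ring

end Model

/-- The integrand of the second order expression, as a complex number. -/
noncomputable def density (p : Fin L) (P : BMat K L) (Φ : FMat K L) : ℂ :=
  trK K
    (entry (Φᴴ * ((2 : ℂ) • (Pᴴ * P) + P * P + Pᴴ * Pᴴ) * Φ) p p
      - ∑ q ∈ Finset.Iic p, (if q = p then (1 : ℂ) else 2) •
          (entry (Φᴴ * (Pᴴ + P) * Φ) p q * entry (Φᴴ * (Pᴴ + P) * Φ) q p))

/-- The trace of scalar blocks is spelled out in complex entries, since the moments are known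
entrywise. -/
lemma density_eq_sum (p : Fin L) (P : BMat K L) (Φ : FMat K L) :
    density p P Φ = (K.dim : ℂ)⁻¹ *
      ((∑ s, (Φᴴ * ((2 : ℂ) • (Pᴴ * P) + P * P + Pᴴ * Pᴴ) * Φ) (p, s) (p, s)) -
        ∑ q ∈ Finset.Iic p, (if q = p then (1 : ℂ) else 2) * ∑ s, ∑ t,
          (Φᴴ * (Pᴴ + P) * Φ) (p, s) (q, t) * (Φᴴ * (Pᴴ + P) * Φ) (q, t) (p, s)) := by
  unfold density trK
  rw [Matrix.trace_sub, Matrix.trace_sum]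
  simp only [Matrix.trace_smul, smul_eq_mul]
  rfl

/-- Moments of the phases `U`, `V` that determine the average of the second order expression
with coupling matrix `B`. -/
structure PhaseMoments (M : Model K L) (μ : Measure (FMat K L)) (B : SMat K L)
    (c : Ix K L → Ix K L → ℂ) : Prop where
  memU : ∀ i a, MemLp (fun Φ : FMat K L => phaseU Φ i a) ⊤ μ
  memV : ∀ i a, MemLp (fun Φ : FMat K L => phaseV Φ i a) ⊤ μ
  hypU : ∀ᵐ Φ ∂μ, ∀ i b, ¬M.Lh ≤ b.1.1 → phaseU Φ i b = if i = b then 1 else 0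
  hypV : ∀ᵐ Φ ∂μ, ∀ i b, ¬M.Lh ≤ b.1.1 → phaseV Φ i b = if i = b then 1 else 0
  twoU : ∀ a, M.Lh ≤ a.1.1 → ∀ i j, ∫ Φ, star (phaseU Φ i a) * phaseU Φ j a ∂μ =
    if i = j then M.ind i * (Fintype.card M.EIx : ℂ)⁻¹ else 0
  twoV : ∀ a, M.Lh ≤ a.1.1 → ∀ i j, ∫ Φ, star (phaseV Φ i a) * phaseV Φ j a ∂μ =
    if i = j then M.ind i * (Fintype.card M.EIx : ℂ)⁻¹ else 0
  twoUV : ∀ a, M.Lh ≤ a.1.1 → ∀ i j, ∫ Φ, star (phaseU Φ i a) * phaseV Φ j a ∂μ = 0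
  four : ∀ a b, M.Lh ≤ a.1.1 → M.Lh ≤ b.1.1 →
    ∫ Φ, star (((phaseU Φ)ᴴ * B * phaseV Φ) a b) * ((phaseU Φ)ᴴ * B * phaseV Φ) a b ∂μ =
      c a b * M.ellWeight B
  four_zero : ∀ a b, M.Lh ≤ a.1.1 → M.Lh ≤ b.1.1 →
    ∫ Φ, ((phaseU Φ)ᴴ * B * phaseV Φ) a b * ((phaseU Φ)ᴴ * B * phaseV Φ) b a ∂μ = 0

lemma sandwich_apply (U X V : SMat K L) (a b : Ix K L) :
    (Uᴴ * X * V) a b = ∑ i, ∑ j, X i j * (star (U i a) * V j b) := by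
  rw [Matrix.mul_apply, Finset.sum_comm]
  refine Finset.sum_congr rfl fun j _ => ?_
  rw [Matrix.mul_apply, Finset.sum_mul]
  refine Finset.sum_congr rfl fun i _ => ?_
  rw [Matrix.conjTranspose_apply]; ring

/-! ### Averages of sesquilinear expressions in the phases -/

section Sandwich

variable {μ : Measure (FMat K L)} {F G : FMat K L → SMat K L}

lemma memLp_sandwich (hF : ∀ i a, MemLp (fun Φ => F Φ i a) ⊤ μ)
    (hG : ∀ i a, MemLp (fun Φ => G Φ i a) ⊤ μ) (X : SMat K L) (a b : Ix K L) :
    MemLp (fun Φ => ((F Φ)ᴴ * X * G Φ) a b) ⊤ μ := by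
  simp only [sandwich_apply]
  exact memLp_finsetSum _ fun i _ => memLp_finsetSum _ fun j _ =>
    (MemLp.mul_top (MemLp.star_top (hF i a)) (hG j b)).const_mul _

lemma integral_sandwich [IsFiniteMeasure μ] (hF : ∀ i a, MemLp (fun Φ => F Φ i a) ⊤ μ)
    (hG : ∀ i a, MemLp (fun Φ => G Φ i a) ⊤ μ) (X : SMat K L) (a b : Ix K L) :
    ∫ Φ, ((F Φ)ᴴ * X * G Φ) a b ∂μ =
      ∑ i, ∑ j, X i j * ∫ Φ, star (F Φ i a) * G Φ j b ∂μ := by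
  have hi : ∀ i j, Integrable (fun Φ => X i j * (star (F Φ i a) * G Φ j b)) μ := fun i j =>
    (MemLp.integrable_top (MemLp.mul_top (MemLp.star_top (hF i a)) (hG j b))).const_mul _
  simp only [sandwich_apply]
  rw [integral_finsetSum _ fun i _ => integrable_finsetSum _ fun j _ => hi i j]
  refine Finset.sum_congr rfl fun i _ => ?_
  rw [integral_finsetSum _ fun j _ => hi i j]
  simp only [integral_const_mul]

end Sandwich

/-! ### Average of the second order expression from the moments of the phases -/

namespace PhaseMoments

variable {M : Model K L} {μ : Measure (FMat K L)} {c : Ix K L → Ix K L → ℂ}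

/-- An elliptic column of `U` or `V` has covariance `N⁻¹` times the elliptic projection. Hence `BB*`
contributes the rows of `B` with elliptic index and `B*B` the columns; the cross terms with `Z`
average to zero. -/
lemma integral_quadratic [IsProbabilityMeasure μ] {B : SMat K L} (h : PhaseMoments M μ B c)
    (Z : SMat K L) {a : Ix K L} (ha : M.Lh ≤ a.1.1) :
    ∫ Φ, ((2 : ℂ) • ((phaseU Φ)ᴴ * (B * Bᴴ) * phaseU Φ) +
      (2 : ℂ) • ((phaseV Φ)ᴴ * (Bᴴ * B) * phaseV Φ) +
      ((phaseU Φ)ᴴ * Z * phaseV Φ + ((phaseU Φ)ᴴ * Z * phaseV Φ)ᴴ)) a a ∂μ =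
    2 * (Fintype.card M.EIx : ℂ)⁻¹ *
      ∑ i, ∑ j, (M.ind i + M.ind j) * (B i j * star (B i j)) := by
  simp only [Matrix.add_apply, Matrix.smul_apply, smul_eq_mul, Matrix.conjTranspose_apply]
  have i1 := memLp_sandwich h.memU h.memU (B * Bᴴ) a a
  have i2 := memLp_sandwich h.memV h.memV (Bᴴ * B) a a
  have i3 := memLp_sandwich h.memU h.memV Z a a
  have i4 := MemLp.star_top i3
  have z : ∫ Φ, ((phaseU Φ)ᴴ * Z * phaseV Φ) a a ∂μ = 0 := by
    rw [integral_sandwich h.memU h.memV]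
    simp only [h.twoUV a ha, mul_zero, Finset.sum_const_zero]
  have z' : ∫ Φ, star (((phaseU Φ)ᴴ * Z * phaseV Φ) a a) ∂μ = 0 := by
    have := integral_conj (μ := μ) (f := fun Φ => ((phaseU Φ)ᴴ * Z * phaseV Φ) a a)
    rw [z] at this
    simpa using this
  rw [integral_add, integral_add, integral_add, integral_const_mul, integral_const_mul, z, z',
    integral_sandwich h.memU h.memU, integral_sandwich h.memV h.memV]
  · simp only [h.twoU a ha, h.twoV a ha, mul_ite, mul_zero, Finset.sum_ite_eq, Finset.mem_univ,
      if_true, add_zero, add_mul, Finset.sum_add_distrib, mul_add, Matrix.mul_apply,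
      Matrix.conjTranspose_apply]
    congr 1
    · simp only [Finset.mul_sum, Finset.sum_mul]
      refine Finset.sum_congr rfl fun i _ => Finset.sum_congr rfl fun j _ => ?_
      ring
    · rw [Finset.sum_comm (f := fun i j => M.ind j * (B i j * star (B i j)))]
      simp only [Finset.mul_sum, Finset.sum_mul]
      refine Finset.sum_congr rfl fun i _ => Finset.sum_congr rfl fun j _ => ?_
      ring
  · exact MemLp.integrable_top i3
  · exact MemLp.integrable_top i4
  · exact (MemLp.integrable_top i1).const_mul _
  · exact (MemLp.integrable_top i2).const_mul _
  · exact ((MemLp.integrable_top i1).const_mul _).add ((MemLp.integrable_top i2).const_mul _)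
  · exact (MemLp.integrable_top i3).add (MemLp.integrable_top i4)

lemma integral_product_split [IsProbabilityMeasure μ] {B : SMat K L} (h : PhaseMoments M μ B c)
    (a b : Ix K L) :
    ∫ Φ, ((phaseU Φ)ᴴ * B * phaseV Φ + ((phaseU Φ)ᴴ * B * phaseV Φ)ᴴ) a b *
        ((phaseU Φ)ᴴ * B * phaseV Φ + ((phaseU Φ)ᴴ * B * phaseV Φ)ᴴ) b a ∂μ =
      (∫ Φ, star (((phaseU Φ)ᴴ * B * phaseV Φ) a b) * ((phaseU Φ)ᴴ * B * phaseV Φ) a b ∂μ) +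
      (∫ Φ, star (((phaseU Φ)ᴴ * B * phaseV Φ) b a) * ((phaseU Φ)ᴴ * B * phaseV Φ) b a ∂μ) +
      ((∫ Φ, ((phaseU Φ)ᴴ * B * phaseV Φ) a b * ((phaseU Φ)ᴴ * B * phaseV Φ) b a ∂μ) +
      star (∫ Φ, ((phaseU Φ)ᴴ * B * phaseV Φ) a b * ((phaseU Φ)ᴴ * B * phaseV Φ) b a ∂μ)) := by
  have hW := memLp_sandwich h.memU h.memV B
  have hs : star (∫ Φ, ((phaseU Φ)ᴴ * B * phaseV Φ) a b * ((phaseU Φ)ᴴ * B * phaseV Φ) b a ∂μ) =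
      ∫ Φ, star (((phaseU Φ)ᴴ * B * phaseV Φ) a b * ((phaseU Φ)ᴴ * B * phaseV Φ) b a) ∂μ :=
    integral_conj.symm
  have j1 := MemLp.integrable_top (MemLp.mul_top (MemLp.star_top (hW a b)) (hW a b))
  have j2 := MemLp.integrable_top (MemLp.mul_top (MemLp.star_top (hW b a)) (hW b a))
  have j3 := MemLp.integrable_top (MemLp.mul_top (hW a b) (hW b a))
  have j4 := MemLp.integrable_top (MemLp.star_top (MemLp.mul_top (hW a b) (hW b a)))
  rw [hs, ← integral_add j1 j2, ← integral_add j3 j4]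
  refine Eq.trans ?_ (integral_add (j1.add j2) (j3.add j4))
  congr 1
  funext Φ
  simp only [Matrix.add_apply, Matrix.conjTranspose_apply, star_mul']
  ring

lemma integral_product_ell [IsProbabilityMeasure μ] {B : SMat K L} (h : PhaseMoments M μ B c)
    {a b : Ix K L} (ha : M.Lh ≤ a.1.1) (hb : M.Lh ≤ b.1.1) :
    ∫ Φ, ((phaseU Φ)ᴴ * B * phaseV Φ + ((phaseU Φ)ᴴ * B * phaseV Φ)ᴴ) a b *
        ((phaseU Φ)ᴴ * B * phaseV Φ + ((phaseU Φ)ᴴ * B * phaseV Φ)ᴴ) b a ∂μ =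
      (c a b + c b a) * M.ellWeight B := by
  rw [h.integral_product_split, h.four a b ha hb, h.four b a hb ha, h.four_zero a b ha hb]
  simp; ring

/-- For hyperbolic `b` the columns `b` of `U` and `V` are the basis vector `e_b`, so `W_ab` and
`W_ba` are linear in the phases. Second moments suffice, and the result is the same in all classes.
-/
lemma integral_product_hyp [IsProbabilityMeasure μ] {B : SMat K L} (h : PhaseMoments M μ B c)
    {a b : Ix K L} (ha : M.Lh ≤ a.1.1) (hb : ¬M.Lh ≤ b.1.1) :
    ∫ Φ, ((phaseU Φ)ᴴ * B * phaseV Φ + ((phaseU Φ)ᴴ * B * phaseV Φ)ᴴ) a b *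
        ((phaseU Φ)ᴴ * B * phaseV Φ + ((phaseU Φ)ᴴ * B * phaseV Φ)ᴴ) b a ∂μ =
      (Fintype.card M.EIx : ℂ)⁻¹ *
        ∑ i, M.ind i * (B i b * star (B i b) + B b i * star (B b i)) := by
  have hab : ∀ᵐ Φ ∂μ, ((phaseU Φ)ᴴ * B * phaseV Φ) a b = ∑ i, B i b * star (phaseU Φ i a) := by
    filter_upwards [h.hypV] with Φ hΦ
    rw [sandwich_apply]
    refine Finset.sum_congr rfl fun i _ => ?_
    simp [hΦ _ b hb]
  have hba : ∀ᵐ Φ ∂μ, ((phaseU Φ)ᴴ * B * phaseV Φ) b a = ∑ j, B b j * phaseV Φ j a := by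
    filter_upwards [h.hypU] with Φ hΦ
    rw [sandwich_apply, Finset.sum_comm]
    refine Finset.sum_congr rfl fun i _ => ?_
    simp only [hΦ _ b hb]
    rw [Finset.sum_eq_single b (by intro k _ hk; simp [hk]) (by simp)]
    simp
  have e1 : ∫ Φ, star (((phaseU Φ)ᴴ * B * phaseV Φ) a b) * ((phaseU Φ)ᴴ * B * phaseV Φ) a b ∂μ =
      (Fintype.card M.EIx : ℂ)⁻¹ * ∑ i, M.ind i * (B i b * star (B i b)) := by
    have : ∀ᵐ Φ ∂μ, star (((phaseU Φ)ᴴ * B * phaseV Φ) a b) * ((phaseU Φ)ᴴ * B * phaseV Φ) a b =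
        ((phaseU Φ)ᴴ * (Matrix.of fun i j => B i b * star (B j b)) * phaseU Φ) a a := by
      filter_upwards [hab] with Φ hΦ
      rw [hΦ, sandwich_apply, star_sum, mul_comm, Finset.sum_mul_sum]
      refine Finset.sum_congr rfl fun i _ => Finset.sum_congr rfl fun j _ => ?_
      simp only [star_mul', star_star, Matrix.of_apply]; ring
    rw [integral_congr_ae this, integral_sandwich h.memU h.memU]
    simp only [h.twoU a ha, mul_ite, mul_zero, Finset.sum_ite_eq, Finset.mem_univ, if_true,
      Matrix.of_apply, Finset.mul_sum]
    exact Finset.sum_congr rfl fun i _ => by ring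
  have e2 : ∫ Φ, star (((phaseU Φ)ᴴ * B * phaseV Φ) b a) * ((phaseU Φ)ᴴ * B * phaseV Φ) b a ∂μ =
      (Fintype.card M.EIx : ℂ)⁻¹ * ∑ i, M.ind i * (B b i * star (B b i)) := by
    have : ∀ᵐ Φ ∂μ, star (((phaseU Φ)ᴴ * B * phaseV Φ) b a) * ((phaseU Φ)ᴴ * B * phaseV Φ) b a =
        ((phaseV Φ)ᴴ * (Matrix.of fun i j => star (B b i) * B b j) * phaseV Φ) a a := by
      filter_upwards [hba] with Φ hΦ
      rw [hΦ, sandwich_apply, star_sum, Finset.sum_mul_sum]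
      refine Finset.sum_congr rfl fun i _ => Finset.sum_congr rfl fun j _ => ?_
      simp only [star_mul', Matrix.of_apply]; ring
    rw [integral_congr_ae this, integral_sandwich h.memV h.memV]
    simp only [h.twoV a ha, mul_ite, mul_zero, Finset.sum_ite_eq, Finset.mem_univ, if_true,
      Matrix.of_apply, Finset.mul_sum]
    exact Finset.sum_congr rfl fun i _ => by ring
  have e3 : ∫ Φ, ((phaseU Φ)ᴴ * B * phaseV Φ) a b * ((phaseU Φ)ᴴ * B * phaseV Φ) b a ∂μ = 0 := by
    have : ∀ᵐ Φ ∂μ, ((phaseU Φ)ᴴ * B * phaseV Φ) a b * ((phaseU Φ)ᴴ * B * phaseV Φ) b a =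
        ((phaseU Φ)ᴴ * (Matrix.of fun i j => B i b * B b j) * phaseV Φ) a a := by
      filter_upwards [hab, hba] with Φ hΦ hΦ'
      rw [hΦ, hΦ', sandwich_apply, Finset.sum_mul_sum]
      refine Finset.sum_congr rfl fun i _ => Finset.sum_congr rfl fun j _ => ?_
      simp only [Matrix.of_apply]; ring
    rw [integral_congr_ae this, integral_sandwich h.memU h.memV]
    simp only [h.twoUV a ha, mul_zero, Finset.sum_const_zero]
  rw [h.integral_product_split, e1, e2, e3]
  simp only [mul_add, Finset.sum_add_distrib, star_zero, add_zero]

/-- The average of the second order integrand at fixed `P`. -/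
lemma integral_density [IsProbabilityMeasure μ] {P : BMat K L} (hP : IsHS P)
    (h : PhaseMoments M μ (coupling P) c) {p : Fin L} (hp : M.Lh ≤ p.1) {cd co : ℂ}
    (hcd : ∑ s, ∑ t, (c (p, s) (p, t) + c (p, t) (p, s)) = 2 * cd)
    (hco : ∀ q : Fin L, M.Lh ≤ q.1 → q < p →
      ∑ s, ∑ t, (c (p, s) (q, t) + c (q, t) (p, s)) = 2 * co) :
    ∫ Φ, density p P Φ ∂μ = (K.dim : ℂ)⁻¹ * M.ellWeight (coupling P) *
      (4 * K.dim * (Fintype.card M.EIx : ℂ)⁻¹ - 4 * ((p : ℂ) - M.Lh) * co - 2 * cd) := by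
  obtain ⟨Z, hZ⟩ := frame_form_quadratic hP
  set B := coupling P with hB
  have hW := memLp_sandwich h.memU h.memV B
  have hH : ∀ a b, MemLp (fun Φ : FMat K L =>
      ((phaseU Φ)ᴴ * B * phaseV Φ + ((phaseU Φ)ᴴ * B * phaseV Φ)ᴴ) a b) ⊤ μ :=
    fun a b => (hW a b).add (MemLp.star_top (hW b a))
  have hHH : ∀ a b, Integrable (fun Φ : FMat K L =>
      ((phaseU Φ)ᴴ * B * phaseV Φ + ((phaseU Φ)ᴴ * B * phaseV Φ)ᴴ) a b *
      ((phaseU Φ)ᴴ * B * phaseV Φ + ((phaseU Φ)ᴴ * B * phaseV Φ)ᴴ) b a) μ :=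
    fun a b => MemLp.integrable_top (MemLp.mul_top (hH a b) (hH b a))
  have hQ : ∀ a, Integrable (fun Φ : FMat K L => ((2 : ℂ) • ((phaseU Φ)ᴴ * (B * Bᴴ) * phaseU Φ) +
      (2 : ℂ) • ((phaseV Φ)ᴴ * (Bᴴ * B) * phaseV Φ) +
      ((phaseU Φ)ᴴ * Z * phaseV Φ + ((phaseU Φ)ᴴ * Z * phaseV Φ)ᴴ)) a a) μ := by
    intro a
    have i3 := MemLp.integrable_top (memLp_sandwich h.memU h.memV Z a a)
    exact (((MemLp.integrable_top (memLp_sandwich h.memU h.memU (B * Bᴴ) a a)).const_mul 2).add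
      ((MemLp.integrable_top (memLp_sandwich h.memV h.memV (Bᴴ * B) a a)).const_mul 2)).add
      (i3.add (MemLp.integrable_top (MemLp.star_top (memLp_sandwich h.memU h.memV Z a a))))
  simp only [density_eq_sum, frame_form_add hP, hZ, reflection, ← hB]
  rw [integral_const_mul, integral_sub, integral_finsetSum _ fun s _ => hQ (p, s),
    integral_finsetSum]
  rotate_left
  · exact fun q _ => (integrable_finsetSum _ fun s _ =>
      integrable_finsetSum _ fun t _ => hHH _ _).const_mul _
  · exact integrable_finsetSum _ fun s _ => hQ (p, s)
  · exact integrable_finsetSum _ fun q _ => (integrable_finsetSum _ fun s _ =>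
      integrable_finsetSum _ fun t _ => hHH _ _).const_mul _
  have hsum : ∀ q : Fin L, ∫ Φ : FMat K L, (if q = p then (1 : ℂ) else 2) * ∑ s, ∑ t,
      ((phaseU Φ)ᴴ * B * phaseV Φ + ((phaseU Φ)ᴴ * B * phaseV Φ)ᴴ) (p, s) (q, t) *
      ((phaseU Φ)ᴴ * B * phaseV Φ + ((phaseU Φ)ᴴ * B * phaseV Φ)ᴴ) (q, t) (p, s) ∂μ =
      (if q = p then (1 : ℂ) else 2) * ∑ s, ∑ t, ∫ Φ : FMat K L,
      ((phaseU Φ)ᴴ * B * phaseV Φ + ((phaseU Φ)ᴴ * B * phaseV Φ)ᴴ) (p, s) (q, t) *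
      ((phaseU Φ)ᴴ * B * phaseV Φ + ((phaseU Φ)ᴴ * B * phaseV Φ)ᴴ) (q, t) (p, s) ∂μ := by
    intro q
    rw [integral_const_mul, integral_finsetSum _ fun s _ =>
      integrable_finsetSum _ fun t _ => hHH _ _]
    congr 1
    exact Finset.sum_congr rfl fun s _ => integral_finsetSum _ fun t _ => hHH _ _
  rw [Finset.sum_congr rfl fun q _ => hsum q]
  have hell : ∀ q : Fin L, M.Lh ≤ q.1 → ∑ s, ∑ t, ∫ Φ : FMat K L,
      ((phaseU Φ)ᴴ * B * phaseV Φ + ((phaseU Φ)ᴴ * B * phaseV Φ)ᴴ) (p, s) (q, t) *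
      ((phaseU Φ)ᴴ * B * phaseV Φ + ((phaseU Φ)ᴴ * B * phaseV Φ)ᴴ) (q, t) (p, s) ∂μ =
      (∑ s, ∑ t, (c (p, s) (q, t) + c (q, t) (p, s))) * M.ellWeight B := by
    intro q hq
    simp only [Finset.sum_mul]
    exact Finset.sum_congr rfl fun s _ => Finset.sum_congr rfl fun t _ =>
      h.integral_product_ell hp hq
  have hhyp : ∀ q : Fin L, ¬M.Lh ≤ q.1 → ∑ s, ∑ t, ∫ Φ : FMat K L,
      ((phaseU Φ)ᴴ * B * phaseV Φ + ((phaseU Φ)ᴴ * B * phaseV Φ)ᴴ) (p, s) (q, t) *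
      ((phaseU Φ)ᴴ * B * phaseV Φ + ((phaseU Φ)ᴴ * B * phaseV Φ)ᴴ) (q, t) (p, s) ∂μ =
      K.dim * (Fintype.card M.EIx : ℂ)⁻¹ * ∑ t,
        ∑ i, M.ind i * (B i (q, t) * star (B i (q, t)) + B (q, t) i * star (B (q, t) i)) := by
    intro q hq
    rw [Finset.sum_congr rfl fun s _ => Finset.sum_congr rfl fun t _ =>
      h.integral_product_hyp (a := (p, s)) (b := (q, t)) hp hq]
    rw [Finset.sum_const, Finset.card_univ, Fintype.card_fin, nsmul_eq_mul, ← Finset.mul_sum,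
      mul_assoc]
  have hsplit : ∑ q ∈ Finset.Iic p, (if q = p then (1 : ℂ) else 2) * ∑ s, ∑ t, ∫ Φ : FMat K L,
      ((phaseU Φ)ᴴ * B * phaseV Φ + ((phaseU Φ)ᴴ * B * phaseV Φ)ᴴ) (p, s) (q, t) *
      ((phaseU Φ)ᴴ * B * phaseV Φ + ((phaseU Φ)ᴴ * B * phaseV Φ)ᴴ) (q, t) (p, s) ∂μ =
      (4 * ((p : ℂ) - M.Lh) * co + 2 * cd) * M.ellWeight B +
      2 * (K.dim * (Fintype.card M.EIx : ℂ)⁻¹) * ∑ q : Fin L, ∑ t, (1 - M.ind (q, t)) *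
        ∑ i, M.ind i * (B i (q, t) * star (B i (q, t)) + B (q, t) i * star (B (q, t) i)) := by
    -- Elliptic `q` yield the class dependent term, hyperbolic `q` the correction that cancels
    -- against the quadratic part.
    rw [← Finset.sum_filter_add_sum_filter_not (Finset.Iic p) (fun q : Fin L => M.Lh ≤ q.1)]
    congr 1
    · have hmem : p ∈ (Finset.Iic p).filter (fun q : Fin L => M.Lh ≤ q.1) := by simp [hp]
      rw [← Finset.add_sum_erase _ _ hmem, if_pos rfl, hell p hp, hcd]
      -- Channels are numbered from 0, so the elliptic channels strictly below `p` are `Lh, …, p -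
      -- 1`.
      have hcard : (((Finset.Iic p).filter (fun q : Fin L => M.Lh ≤ q.1)).erase p).card =
          p.1 - M.Lh := by
        have hLh : M.Lh < L := lt_of_le_of_lt hp p.2
        have : ((Finset.Iic p).filter (fun q : Fin L => M.Lh ≤ q.1)).erase p =
            Finset.Ico (⟨M.Lh, hLh⟩ : Fin L) p := by
          ext q
          simp only [Finset.mem_erase, Finset.mem_filter, Finset.mem_Iic, Finset.mem_Ico,
            Fin.le_def, Fin.lt_def, ne_eq, Fin.ext_iff]
          omega
        rw [this, Fin.card_Ico]
      have hc : ∀ q ∈ ((Finset.Iic p).filter (fun q : Fin L => M.Lh ≤ q.1)).erase p,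
          (if q = p then (1 : ℂ) else 2) * ∑ s, ∑ t, ∫ Φ : FMat K L,
          ((phaseU Φ)ᴴ * B * phaseV Φ + ((phaseU Φ)ᴴ * B * phaseV Φ)ᴴ) (p, s) (q, t) *
          ((phaseU Φ)ᴴ * B * phaseV Φ + ((phaseU Φ)ᴴ * B * phaseV Φ)ᴴ) (q, t) (p, s) ∂μ =
          4 * co * M.ellWeight B := by
        intro q hq
        simp only [Finset.mem_erase, Finset.mem_filter, Finset.mem_Iic] at hq
        rw [if_neg hq.1, hell q hq.2.2, hco q hq.2.2 (lt_of_le_of_ne hq.2.1 hq.1)]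
        ring
      rw [Finset.sum_congr rfl hc, Finset.sum_const, hcard, nsmul_eq_mul, Nat.cast_sub hp]
      ring
    · rw [Finset.mul_sum]
      -- Every hyperbolic channel lies below the elliptic `p`, so the restriction `q ≤ p` can be
      -- dropped; the factor `1 - ind` removes the elliptic channels.
      refine Finset.sum_subset_zero_on_sdiff (Finset.subset_univ _) ?_ ?_
      · intro q hq
        have hq' : M.Lh ≤ q.1 := by
          by_contra hcon
          simp only [Finset.mem_sdiff, Finset.mem_univ, Finset.mem_filter, Finset.mem_Iic,
            true_and, hcon, not_false_eq_true, and_true, Fin.le_def] at hq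
          omega
        simp [M.ind_of_le (i := (q, _)) hq']
      · intro q hq
        simp only [Finset.mem_filter, Finset.mem_Iic] at hq
        have hne : q ≠ p := fun hh => hq.2 (hh ▸ hp)
        rw [if_neg hne, hhyp q hq.2]
        have : ∀ t, (1 - M.ind (q, t) : ℂ) = 1 := fun t => by
          rw [M.ind_of_not_le (i := (q, t)) hq.2, sub_zero]
        simp only [this, one_mul]
        ring
  rw [hsplit]
  rw [Finset.sum_congr rfl fun s _ => h.integral_quadratic Z (a := (p, s)) hp]
  rw [Finset.sum_const, Finset.card_univ, Fintype.card_fin, nsmul_eq_mul]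
  -- Splitting each index into elliptic and hyperbolic: pairs of elliptic indices count twice, mixed
  -- pairs once. The mixed part equals the hyperbolic contribution in `hsplit` and drops out of the
  -- difference.
  have hS : ∑ i, ∑ j, (M.ind i + M.ind j) * (B i j * star (B i j)) =
      2 * M.ellWeight B + ∑ q : Fin L, ∑ t, (1 - M.ind (q, t)) *
        ∑ i, M.ind i * (B i (q, t) * star (B i (q, t)) + B (q, t) i * star (B (q, t) i)) := by
    rw [← Fintype.sum_prod_type (f := fun b : Ix K L => (1 - M.ind b) *
        ∑ i, M.ind i * (B i b * star (B i b) + B b i * star (B b i)))]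
    have : ∑ b : Ix K L, (1 - M.ind b) *
        ∑ i, M.ind i * (B i b * star (B i b) + B b i * star (B b i)) =
        ∑ i, ∑ j, ((1 - M.ind j) * M.ind i + (1 - M.ind i) * M.ind j) * (B i j * star (B i j)) := by
      simp only [add_mul, mul_add, Finset.sum_add_distrib]
      congr 1
      · rw [Finset.sum_comm]
        refine Finset.sum_congr rfl fun i _ => ?_
        rw [Finset.mul_sum]
        exact Finset.sum_congr rfl fun j _ => by ring
      · refine Finset.sum_congr rfl fun i _ => ?_
        rw [Finset.mul_sum]
        exact Finset.sum_congr rfl fun j _ => by ring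
    rw [this, Model.ellWeight]
    simp only [Finset.mul_sum, ← Finset.sum_add_distrib]
    exact Finset.sum_congr rfl fun i _ => Finset.sum_congr rfl fun j _ => by ring
  rw [hS]
  ring

end PhaseMoments

end RandomPhase

namespace RandomPhase

variable {K : SymClass} {L : ℕ}

/-! ### Moments of the phases under the geometric measure -/

namespace Model

lemma sum_ind (M : Model K L) (f : Ix K L → ℂ) :
    ∑ i, M.ind i * f i = ∑ i : M.EIx, f i.1 := by
  simp only [ind, ite_mul, one_mul, zero_mul]
  rw [← Finset.sum_filter]
  exact Finset.sum_subtype _ (by simp) f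

lemma card_EIx (M : Model K L) : Fintype.card M.EIx = M.Le * K.dim := by
  have e : M.EIx ≃ {l : Fin L // M.Lh ≤ l.1} × Fin K.dim :=
    { toFun := fun i => (⟨i.1.1, i.2⟩, i.1.2)
      invFun := fun x => ⟨(x.1.1, x.2), x.1.2⟩
      left_inv := fun _ => rfl
      right_inv := fun _ => rfl }
  rw [Fintype.card_congr e, Fintype.card_prod, Fintype.card_fin]
  congr 1
  rw [Fintype.card_subtype, Le]
  have h1 := Finset.card_filter_add_card_filter_not (s := (Finset.univ : Finset (Fin L)))
    (fun l => l.1 < M.Lh)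
  have h2 : (Finset.univ.filter fun l : Fin L => l.1 < M.Lh).card = M.Lh := by
    rw [Fin.card_filter_val_lt]
    exact min_eq_right M.Lh_le
  simp only [not_lt, Finset.card_univ, Fintype.card_fin] at h1
  omega

end Model

/-- A random matrix which is the identity on the hyperbolic channels and Haar distributed on the
elliptic ones. -/
structure HaarPhase (M : Model K L) (μ : Measure (FMat K L)) (X : FMat K L → SMat K L) :
    Prop where
  meas : ∀ i a, Measurable fun Φ => X Φ i a
  mem : ∀ i a, MemLp (fun Φ => X Φ i a) ⊤ μ
  block : ∀ᵐ Φ ∂μ, ∀ i b, X Φ i b = M.ind i * M.ind b * X Φ i b + if i = b then 1 - M.ind i else 0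
  haar : IsHaarUnitary (μ.map fun Φ => M.blockE (X Φ))

namespace HaarPhase

variable {M : Model K L} {μ : Measure (FMat K L)} {X : FMat K L → SMat K L}

lemma hyp (h : HaarPhase M μ X) :
    ∀ᵐ Φ ∂μ, ∀ i b, ¬M.Lh ≤ b.1.1 → X Φ i b = if i = b then 1 else 0 := by
  filter_upwards [h.block] with Φ hΦ i b hb
  rw [hΦ i b, M.ind_of_not_le hb]
  by_cases hib : i = b
  · subst hib
    simp [M.ind_of_not_le hb]
  · simp [hib]

lemma zero (h : HaarPhase M μ X) :
    ∀ᵐ Φ ∂μ, ∀ i a, M.Lh ≤ a.1.1 → ¬M.Lh ≤ i.1.1 → X Φ i a = 0 := by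
  filter_upwards [h.block] with Φ hΦ i a ha hi
  have hne : i ≠ a := fun hh => hi (hh ▸ ha)
  rw [hΦ i a, M.ind_of_not_le hi]
  simp [hne]

lemma ind_mul (h : HaarPhase M μ X) :
    ∀ᵐ Φ ∂μ, ∀ i a, M.Lh ≤ a.1.1 → X Φ i a = M.ind i * X Φ i a := by
  filter_upwards [h.zero] with Φ hΦ i a ha
  by_cases hi : M.Lh ≤ i.1.1
  · rw [M.ind_of_le hi, one_mul]
  · rw [hΦ i a ha hi, mul_zero]

/-- Moments with elliptic column indices become Haar moments of the elliptic block; entries in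
hyperbolic rows vanish there and are treated separately in the lemmas that follow. -/
lemma integral_comp (h : HaarPhase M μ X) {F : Matrix M.EIx M.EIx ℂ → ℂ} (hF : Measurable F) :
    ∫ Φ, F (M.blockE (X Φ)) ∂μ = ∫ u, F u ∂(μ.map fun Φ => M.blockE (X Φ)) := by
  rw [integral_map]
  · exact (measurable_matrix fun (i j : M.EIx) => h.meas i.1 j.1).aemeasurable
  · exact hF.aestronglyMeasurable

lemma moment_one (h : HaarPhase M μ X) {a : Ix K L} (ha : M.Lh ≤ a.1.1) (i : Ix K L) :
    ∫ Φ, X Φ i a ∂μ = 0 := by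
  by_cases hi : M.Lh ≤ i.1.1
  · exact (h.integral_comp (measurable_entry (⟨i, hi⟩ : M.EIx) (⟨a, ha⟩ : M.EIx))).trans
      (h.haar.moment_one _ _)
  · refine integral_eq_zero_of_ae ?_
    filter_upwards [h.zero] with Φ hΦ using hΦ i a ha hi

lemma moment_two_zero (h : HaarPhase M μ X) {a b : Ix K L} (ha : M.Lh ≤ a.1.1)
    (hb : M.Lh ≤ b.1.1) (i j : Ix K L) : ∫ Φ, X Φ i a * X Φ j b ∂μ = 0 := by
  by_cases hij : M.Lh ≤ i.1.1 ∧ M.Lh ≤ j.1.1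
  · exact (h.integral_comp ((measurable_entry (⟨i, hij.1⟩ : M.EIx) (⟨a, ha⟩ : M.EIx)).mul
      (measurable_entry (⟨j, hij.2⟩ : M.EIx) (⟨b, hb⟩ : M.EIx)))).trans
      (h.haar.moment_two_zero _ _ _ _)
  · refine integral_eq_zero_of_ae ?_
    filter_upwards [h.zero] with Φ hΦ
    rcases not_and_or.1 hij with hh | hh
    · simp [hΦ i a ha hh]
    · simp [hΦ j b hb hh]

lemma moment_four_zero (h : HaarPhase M μ X) {a b c d : Ix K L} (ha : M.Lh ≤ a.1.1)
    (hb : M.Lh ≤ b.1.1) (hc : M.Lh ≤ c.1.1) (hd : M.Lh ≤ d.1.1) (i j k l : Ix K L) :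
    ∫ Φ, X Φ i a * X Φ j b * (X Φ k c * X Φ l d) ∂μ = 0 := by
  by_cases hij : (M.Lh ≤ i.1.1 ∧ M.Lh ≤ j.1.1) ∧ M.Lh ≤ k.1.1 ∧ M.Lh ≤ l.1.1
  · exact (h.integral_comp (((measurable_entry (⟨i, hij.1.1⟩ : M.EIx) (⟨a, ha⟩ : M.EIx)).mul
      (measurable_entry (⟨j, hij.1.2⟩ : M.EIx) (⟨b, hb⟩ : M.EIx))).mul
      ((measurable_entry (⟨k, hij.2.1⟩ : M.EIx) (⟨c, hc⟩ : M.EIx)).mul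
      (measurable_entry (⟨l, hij.2.2⟩ : M.EIx) (⟨d, hd⟩ : M.EIx))))).trans
      (h.haar.moment_four_zero _ _ _ _ _ _ _ _)
  · refine integral_eq_zero_of_ae ?_
    filter_upwards [h.zero] with Φ hΦ
    simp only [not_and_or] at hij
    rcases hij with (hh | hh) | hh | hh
    · simp [hΦ i a ha hh]
    · simp [hΦ j b hb hh]
    · simp [hΦ k c hc hh]
    · simp [hΦ l d hd hh]

lemma moment_two (h : HaarPhase M μ X) {a : Ix K L} (ha : M.Lh ≤ a.1.1) (i j : Ix K L) :
    ∫ Φ, star (X Φ i a) * X Φ j a ∂μ =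
      if i = j then M.ind i * (Fintype.card M.EIx : ℂ)⁻¹ else 0 := by
  by_cases hij : M.Lh ≤ i.1.1 ∧ M.Lh ≤ j.1.1
  · refine (h.integral_comp (F := fun u => star (u (⟨i, hij.1⟩ : M.EIx) (⟨a, ha⟩ : M.EIx)) *
      u (⟨j, hij.2⟩ : M.EIx) (⟨a, ha⟩ : M.EIx)) ((continuous_star.measurable.comp (measurable_entry _ _)).mul
      (measurable_entry _ _))).trans ?_
    rw [h.haar.moment_two]
    by_cases hh : i = j
    · subst hh
      simp [M.ind_of_le hij.1]
    · simp [hh]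
  · have h0 : ∫ Φ, star (X Φ i a) * X Φ j a ∂μ = 0 := by
      refine integral_eq_zero_of_ae ?_
      filter_upwards [h.zero] with Φ hΦ
      rcases not_and_or.1 hij with hh | hh
      · simp [hΦ i a ha hh]
      · simp [hΦ j a ha hh]
    rw [h0]
    by_cases hh : i = j
    · subst hh
      have : ¬M.Lh ≤ i.1.1 := fun h' => hij ⟨h', h'⟩
      simp [M.ind_of_not_le this]
    · simp [hh]

lemma sum_eq (h : HaarPhase M μ X) (A : SMat K L) {a b : Ix K L} (ha : M.Lh ≤ a.1.1)
    (hb : M.Lh ≤ b.1.1) : ∀ᵐ Φ ∂μ, ∑ i, ∑ j, A i j * (X Φ i a * X Φ j b) =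
      ∑ i : M.EIx, ∑ j : M.EIx, A i.1 j.1 * (X Φ i.1 a * X Φ j.1 b) := by
  filter_upwards [h.ind_mul] with Φ hΦ
  rw [← M.sum_ind fun i => ∑ j : M.EIx, A i j.1 * (X Φ i a * X Φ j.1 b)]
  refine Finset.sum_congr rfl fun i _ => ?_
  rw [← M.sum_ind fun j => A i j * (X Φ i a * X Φ j b), Finset.mul_sum]
  refine Finset.sum_congr rfl fun j _ => ?_
  conv_lhs => rw [hΦ i a ha, hΦ j b hb]
  ring

lemma moment_quadratic (h : HaarPhase M μ X) {a b : Ix K L} (ha : M.Lh ≤ a.1.1)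
    (hb : M.Lh ≤ b.1.1) (s : ℂ) (hs : s * s = 1) (A : SMat K L)
    (hA : ∀ i j, A j i = s * A i j) :
    ((Fintype.card M.EIx : ℂ) + s) * ∫ Φ,
      star (∑ i, ∑ j, star (A i j) * (X Φ i a * X Φ j b)) *
        (∑ i, ∑ j, star (A i j) * (X Φ i a * X Φ j b)) ∂μ =
      (Fintype.card M.EIx : ℂ)⁻¹ * (1 + s * if a = b then 1 else 0) * M.ellWeight A := by
  have hae : ∀ᵐ Φ ∂μ, star (∑ i, ∑ j, star (A i j) * (X Φ i a * X Φ j b)) *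
        (∑ i, ∑ j, star (A i j) * (X Φ i a * X Φ j b)) =
      (fun u : Matrix M.EIx M.EIx ℂ =>
        star (∑ i, ∑ j, star (M.blockE A i j) * (u i ⟨a, ha⟩ * u j ⟨b, hb⟩)) *
        (∑ i, ∑ j, star (M.blockE A i j) * (u i ⟨a, ha⟩ * u j ⟨b, hb⟩))) (M.blockE (X Φ)) := by
    filter_upwards [h.sum_eq (A.map star) ha hb] with Φ hΦ
    simp only [Matrix.map_apply] at hΦ
    rw [hΦ]
    rfl
  have hm : Measurable fun u : Matrix M.EIx M.EIx ℂ =>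
      ∑ i, ∑ j, star (M.blockE A i j) * (u i ⟨a, ha⟩ * u j ⟨b, hb⟩) :=
    Finset.measurable_sum _ fun i _ => Finset.measurable_sum _ fun j _ =>
      ((measurable_entry _ _).mul (measurable_entry _ _)).const_mul _
  have hm' : Measurable fun u : Matrix M.EIx M.EIx ℂ =>
      star (∑ i, ∑ j, star (M.blockE A i j) * (u i ⟨a, ha⟩ * u j ⟨b, hb⟩)) *
        ∑ i, ∑ j, star (M.blockE A i j) * (u i ⟨a, ha⟩ * u j ⟨b, hb⟩) :=
    (continuous_star.measurable.comp hm).mul hm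
  rw [integral_congr_ae hae, h.integral_comp hm',
    h.haar.moment_quadratic _ _ s hs (M.blockE A) fun i j => hA i.1 j.1]
  have hw : M.ellWeight A = ∑ i, ∑ j, M.blockE A i j * star (M.blockE A i j) := by
    unfold Model.ellWeight
    have : ∀ i, ∑ j, M.ind i * M.ind j * (A i j * star (A i j)) =
        M.ind i * ∑ j : M.EIx, A i j.1 * star (A i j.1) := by
      intro i
      rw [← M.sum_ind fun j => A i j * star (A i j), Finset.mul_sum]
      exact Finset.sum_congr rfl fun j _ => by ring
    simp only [this]
    rw [M.sum_ind]
    rfl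
  rw [hw]
  simp

end HaarPhase

lemma phaseU_apply (Φ : FMat K L) (i a : Ix K L) :
    phaseU Φ i a = Φ (Sum.inl i) a - Complex.I * Φ (Sum.inr i) a := by
  rw [phaseU_eq]; rfl

lemma phaseV_apply (Φ : FMat K L) (i a : Ix K L) :
    phaseV Φ i a = Φ (Sum.inl i) a + Complex.I * Φ (Sum.inr i) a := by
  rw [phaseV_eq]; rfl

lemma measurable_phaseU_apply (i a : Ix K L) : Measurable fun Φ : FMat K L => phaseU Φ i a := by
  simp only [phaseU_apply]
  exact (measurable_entry _ _).sub ((measurable_entry _ _).const_mul _)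

lemma measurable_phaseV_apply (i a : Ix K L) : Measurable fun Φ : FMat K L => phaseV Φ i a := by
  simp only [phaseV_apply]
  exact (measurable_entry _ _).add ((measurable_entry _ _).const_mul _)

namespace Model.IsGeometric

variable {M : Model K L} {μ : Measure (FMat K L)}

lemma memU (h : M.IsGeometric μ) (i a : Ix K L) :
    MemLp (fun Φ : FMat K L => phaseU Φ i a) ⊤ μ := by
  have := h.prob
  refine memLp_top_of_bound (measurable_phaseU_apply i a).aestronglyMeasurable 1 ?_
  filter_upwards [h.frame] with Φ hΦ using entry_norm_bound_of_unitary hΦ.phaseU_mem i a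

lemma memV (h : M.IsGeometric μ) (i a : Ix K L) :
    MemLp (fun Φ : FMat K L => phaseV Φ i a) ⊤ μ := by
  have := h.prob
  refine memLp_top_of_bound (measurable_phaseV_apply i a).aestronglyMeasurable 1 ?_
  filter_upwards [h.frame] with Φ hΦ using entry_norm_bound_of_unitary hΦ.phaseV_mem i a

lemma haarPhaseU (h : M.IsGeometric μ) : HaarPhase M μ phaseU where
  meas := measurable_phaseU_apply
  mem := h.memU
  haar := h.haar
  block := by
    filter_upwards [h.split, h.hyperbolic] with Φ h1 h2 i b
    rw [h2] at h1
    conv_lhs => rw [h1]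
    rw [Model.piH, M.piE_eq, Matrix.add_apply, Matrix.mul_diagonal, Matrix.diagonal_mul,
      Matrix.sub_apply, Matrix.one_apply, Matrix.diagonal_apply]
    split_ifs <;> ring

end Model.IsGeometric

/-- The index of the conjugate basis vector of the same channel. -/
def conjIx (i : Ix K L) : Ix K L := (i.1, i.2.rev)

/-- The sign of the conjugate basis vector. -/
noncomputable def conjSign (i : Ix K L) : ℂ := (-1) ^ i.2.1

lemma conjIx_conjIx (i : Ix K L) : conjIx (conjIx i) = i := by
  simp [conjIx]

/-- The index involution as a permutation. -/
def conjPerm (K : SymClass) (L : ℕ) : Equiv.Perm (Ix K L) :=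
  ⟨conjIx, conjIx, conjIx_conjIx, conjIx_conjIx⟩

lemma star_conjSign (i : Ix K L) : star (conjSign i) = conjSign i := by
  simp [conjSign]

lemma conjSign_mul_self (i : Ix K L) : conjSign i * conjSign i = 1 := by
  rw [conjSign, ← mul_pow]; simp

/-- The sign is `+1` for `ℝ` and `-1` for `ℍ`. It is the only source of the difference between the
two classes: it decides whether the twisted coupling is symmetric or antisymmetric. -/
lemma conjSign_conjIx (i : Ix K L) :
    conjSign (conjIx i) = (-1) ^ (K.dim + 1) * conjSign i := by
  obtain ⟨i, s⟩ := i
  cases K <;> fin_cases s <;> simp [conjSign, conjIx, SymClass.dim, Fin.rev] <;> norm_num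

/-- Puts the reality conditions for `ℝ` and `ℍ` into one formula, so that both classes can share all
later computations. -/
lemma isOver_apply (hK : K ≠ SymClass.complex) {A : SMat K L} (h : IsOver K A) (i j : Ix K L) :
    A i j = conjSign i * conjSign j * star (A (conjIx i) (conjIx j)) := by
  obtain ⟨i, s⟩ := i
  obtain ⟨j, t⟩ := j
  cases K with
  | complex => exact absurd rfl hK
  | real =>
    have := congrFun (congrFun h (i, s)) (j, t)
    fin_cases s; fin_cases t
    simpa [conjSign, conjIx] using this.symm
  | quaternion =>
    have := congrFun (congrFun h (i, s)) (j, t)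
    rw [← this]
    have hq : ∀ (x : Fin L × Fin 2) (k : Fin L) (r : Fin 2), qI (Fin L) x (k, r) =
        if x = (k, r.rev) then (-1 : ℂ) ^ r.1 else 0 := by
      rintro ⟨k', r'⟩ k r
      by_cases hk : k' = k
      · subst hk
        fin_cases r <;> fin_cases r' <;> simp [qI, Fin.rev]
      · simp [qI, hk]
    simp only [Matrix.mul_apply, Matrix.conjTranspose_apply, hq, Matrix.map_apply]
    simp [conjSign, conjIx, apply_ite]
    ring

end RandomPhase

/-! ### Fourth moments in the orthogonal and symplectic classes -/

namespace RandomPhase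

variable {K : SymClass} {L : ℕ}

lemma sum_sum_mul_sum_sum {ι : Type*} [Fintype ι] (f g : ι → ι → ℂ) :
    (∑ i, ∑ j, f i j) * (∑ k, ∑ l, g k l) = ∑ i, ∑ j, ∑ k, ∑ l, f i j * g k l := by
  rw [Finset.sum_mul]
  refine Finset.sum_congr rfl fun i _ => ?_
  rw [Finset.sum_mul]
  refine Finset.sum_congr rfl fun j _ => ?_
  rw [Finset.mul_sum]
  exact Finset.sum_congr rfl fun k _ => by rw [Finset.mul_sum]

/-- `U` and `V` differ by the sign of the imaginary unit, which the antilinear conjugation fixing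
the blocks of `Φ` reverses. So `V` is determined by `U`. -/
lemma phaseV_conj (hK : K ≠ SymClass.complex) {Φ : FMat K L} (h : IsFrame Φ) (i a : Ix K L) :
    phaseV Φ i a = conjSign i * conjSign a * star (phaseU Φ (conjIx i) (conjIx a)) := by
  have h1 := isOver_apply hK h.1 i a
  have h2 := isOver_apply hK h.2.1 i a
  simp only [Matrix.toRows₁_apply, Matrix.toRows₂_apply] at h1 h2
  rw [phaseV_apply, phaseU_apply, h1, h2]
  simp only [star_sub, star_mul', Complex.star_def, Complex.conj_I]
  ring

/-- The off-diagonal blocks of `P` are Hermitian, and so is the sum of its upper left block with its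
adjoint. For Hermitian matrices over `𝕂`, the conjugation symmetry becomes a transposition symmetry,
which is complex linear and survives the factor `Complex.I`. -/
lemma coupling_conj (hK : K ≠ SymClass.complex) {P : BMat K L} (h : IsHS P) (i j : Ix K L) :
    coupling P i j = conjSign i * conjSign j * coupling P (conjIx j) (conjIx i) := by
  obtain ⟨-, h2, h3⟩ := h.blocks
  have e1 := isOver_apply hK h.1.1 i j
  have e1' := congrArg star (isOver_apply hK h.1.1 j i)
  have e2 := isOver_apply hK h.1.2.1 i j
  have e3 := isOver_apply hK h.1.2.2.1 i j
  have f2 := congrFun (congrFun h2 (conjIx j)) (conjIx i)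
  have f3 := congrFun (congrFun h3 (conjIx j)) (conjIx i)
  rw [Matrix.conjTranspose_apply] at f2 f3
  rw [f2] at e2
  rw [f3] at e3
  simp only [star_mul', star_star, star_conjSign] at e1'
  simp only [coupling, Matrix.smul_apply, Matrix.sub_apply, Matrix.add_apply,
    Matrix.conjTranspose_apply, smul_eq_mul]
  rw [e1, e1', e2, e3]
  ring

/-- The coefficients of the fourth moments for `𝕂 = ℝ` (`s = 1`) and `𝕂 = ℍ` (`s = -1`). -/
noncomputable def conjCoeff (N s : ℂ) (a b : Ix K L) : ℂ :=
  N⁻¹ * (1 + s * if a = conjIx b then 1 else 0) / (N + s)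

namespace Model.IsGeometric

variable {M : Model K L} {μ : Measure (FMat K L)}

/-- Eliminating `V` turns `W_ab` into the conjugate of a form with two unconjugated factors of `U`,
the shape needed for `moment_quadratic`. -/
lemma ae_sandwich_conj (h : M.IsGeometric μ) (hK : K ≠ SymClass.complex) (B : SMat K L) :
    ∀ᵐ Φ ∂μ, ∀ a b, ((phaseU Φ)ᴴ * B * phaseV Φ) a b = conjSign b * star (∑ i, ∑ j,
      star (B i (conjIx j) * conjSign (conjIx j)) * (phaseU Φ i a * phaseU Φ j (conjIx b))) := by
  filter_upwards [h.frame] with Φ hΦ a b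
  rw [sandwich_apply, star_sum, Finset.mul_sum]
  refine Finset.sum_congr rfl fun i _ => ?_
  rw [← Equiv.sum_comp (conjPerm K L), star_sum, Finset.mul_sum]
  refine Finset.sum_congr rfl fun j _ => ?_
  have : conjPerm K L j = conjIx j := rfl
  rw [this, phaseV_conj hK hΦ, conjIx_conjIx]
  simp only [star_mul', star_star, star_conjSign]
  ring

lemma phaseMoments_conj (h : M.IsGeometric μ) (hK : K ≠ SymClass.complex) {P : BMat K L}
    (hP : IsHS P) (hN : (Fintype.card M.EIx : ℂ) + (-1) ^ (K.dim + 1) ≠ 0) :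
    PhaseMoments M μ (coupling P)
      (conjCoeff (Fintype.card M.EIx : ℂ) ((-1) ^ (K.dim + 1))) := by
  have := h.prob
  have hU := h.haarPhaseU
  have hind : ∀ i : Ix K L, M.ind (conjIx i) = M.ind i := fun i => rfl
  have hW := h.ae_sandwich_conj hK (coupling P)
  refine ⟨h.memU, h.memV, hU.hyp, ?_, fun a ha i j => hU.moment_two ha i j, ?_, ?_, ?_, ?_⟩
  · filter_upwards [hU.hyp, h.frame] with Φ h1 h2 i b hb
    rw [phaseV_conj hK h2, h1 (conjIx i) (conjIx b) hb]
    have : conjIx i = conjIx b ↔ i = b := (conjPerm K L).injective.eq_iff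
    by_cases hib : i = b
    · subst hib
      simp [conjSign_mul_self]
    · simp [this, hib]
  · intro a ha i j
    have hae : ∀ᵐ Φ ∂μ, star (phaseV Φ i a) * phaseV Φ j a = conjSign i * conjSign j *
        (star (phaseU Φ (conjIx j) (conjIx a)) * phaseU Φ (conjIx i) (conjIx a)) := by
      filter_upwards [h.frame] with Φ hΦ
      rw [phaseV_conj hK hΦ, phaseV_conj hK hΦ]
      simp only [star_mul', star_star, star_conjSign]
      linear_combination conjSign i * conjSign j * phaseU Φ (conjIx i) (conjIx a) *
        star (phaseU Φ (conjIx j) (conjIx a)) * conjSign_mul_self a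
    rw [integral_congr_ae hae, integral_const_mul, hU.moment_two (a := conjIx a) ha]
    have : conjIx j = conjIx i ↔ j = i := (conjPerm K L).injective.eq_iff
    by_cases hib : i = j
    · subst hib
      simp [conjSign_mul_self, hind]
    · simp [this, hib, Ne.symm hib]
  · intro a ha i j
    have hae : ∀ᵐ Φ ∂μ, star (phaseU Φ i a) * phaseV Φ j a = conjSign j * conjSign a *
        star (phaseU Φ i a * phaseU Φ (conjIx j) (conjIx a)) := by
      filter_upwards [h.frame] with Φ hΦ
      rw [phaseV_conj hK hΦ, star_mul']
      ring
    have hc : ∫ Φ, star (phaseU Φ i a * phaseU Φ (conjIx j) (conjIx a)) ∂μ =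
      star (∫ Φ, phaseU Φ i a * phaseU Φ (conjIx j) (conjIx a) ∂μ) := integral_conj
    rw [integral_congr_ae hae, integral_const_mul, hc,
      hU.moment_two_zero (b := conjIx a) ha ha]
    simp
  · intro a b ha hb
    set A : SMat K L := Matrix.of fun i j => coupling P i (conjIx j) * conjSign (conjIx j) with hA
    have hae : ∀ᵐ Φ ∂μ, star (((phaseU Φ)ᴴ * coupling P * phaseV Φ) a b) *
        ((phaseU Φ)ᴴ * coupling P * phaseV Φ) a b =
        star (∑ i, ∑ j, star (A i j) * (phaseU Φ i a * phaseU Φ j (conjIx b))) *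
          (∑ i, ∑ j, star (A i j) * (phaseU Φ i a * phaseU Φ j (conjIx b))) := by
      filter_upwards [hW] with Φ hΦ
      simp only [hΦ, hA, Matrix.of_apply, star_mul' (conjSign b), star_star, star_conjSign b]
      linear_combination (star (∑ i, ∑ j, star (coupling P i (conjIx j) * conjSign (conjIx j)) *
        (phaseU Φ i a * phaseU Φ j (conjIx b))) *
          (∑ i, ∑ j, star (coupling P i (conjIx j) * conjSign (conjIx j)) *
            (phaseU Φ i a * phaseU Φ j (conjIx b)))) * conjSign_mul_self b
    have hs : ((-1 : ℂ) ^ (K.dim + 1)) * (-1) ^ (K.dim + 1) = 1 := by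
      rw [← mul_pow]; simp
    -- Twisting the second index turns the transposition symmetry of the coupling into genuine
    -- symmetry (`ℝ`) or antisymmetry (`ℍ`).
    have hsym : ∀ i j, A j i = (-1) ^ (K.dim + 1) * A i j := by
      intro i j
      simp only [hA, Matrix.of_apply]
      rw [coupling_conj hK hP j (conjIx i), conjIx_conjIx, conjSign_conjIx j]
      linear_combination coupling P i (conjIx j) * conjSign j *
        (conjSign_mul_self (conjIx i) - hs)
    have hq := hU.moment_quadratic (b := conjIx b) ha hb _ hs A hsym
    have hw : M.ellWeight A = M.ellWeight (coupling P) := by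
      unfold Model.ellWeight
      refine Finset.sum_congr rfl fun i _ => ?_
      rw [← Equiv.sum_comp (conjPerm K L)]
      refine Finset.sum_congr rfl fun j _ => ?_
      have : conjPerm K L j = conjIx j := rfl
      simp only [this, hA, Matrix.of_apply, conjIx_conjIx, hind, star_mul', star_conjSign]
      linear_combination M.ind i * M.ind j * (coupling P i j * star (coupling P i j)) *
        conjSign_mul_self j
    rw [hw] at hq
    rw [integral_congr_ae hae, conjCoeff, div_mul_eq_mul_div, eq_div_iff hN, mul_comm, hq]
  · intro a b ha hb
    -- Without a conjugation between the two factors, all four entries of `U` occur with the same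
    -- phase, so the average vanishes.
    have hae : ∀ᵐ Φ ∂μ, ((phaseU Φ)ᴴ * coupling P * phaseV Φ) a b *
        ((phaseU Φ)ᴴ * coupling P * phaseV Φ) b a = conjSign b * conjSign a *
        star (∑ i, ∑ j, ∑ k, ∑ l, star (coupling P i (conjIx j) * conjSign (conjIx j)) *
          star (coupling P k (conjIx l) * conjSign (conjIx l)) *
          (phaseU Φ i a * phaseU Φ j (conjIx b) * (phaseU Φ k b * phaseU Φ l (conjIx a)))) := by
      filter_upwards [hW] with Φ hΦ
      rw [hΦ a b, hΦ b a]
      have : ∀ x y u v : ℂ, x * star u * (y * star v) = x * y * star (u * v) := by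
        intro x y u v; rw [star_mul']; ring
      rw [this]
      congr 2
      rw [sum_sum_mul_sum_sum]
      refine Finset.sum_congr rfl fun i _ => Finset.sum_congr rfl fun j _ =>
        Finset.sum_congr rfl fun k _ => Finset.sum_congr rfl fun l _ => ?_
      ring
    have hint : ∀ i j k l, Integrable (fun Φ : FMat K L =>
        star (coupling P i (conjIx j) * conjSign (conjIx j)) *
          star (coupling P k (conjIx l) * conjSign (conjIx l)) *
          (phaseU Φ i a * phaseU Φ j (conjIx b) * (phaseU Φ k b * phaseU Φ l (conjIx a)))) μ :=
      fun i j k l => (MemLp.integrable_top (MemLp.mul_top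
        (MemLp.mul_top (h.memU _ _) (h.memU _ _))
        (MemLp.mul_top (h.memU _ _) (h.memU _ _)))).const_mul _
    have hc : ∫ Φ, star (∑ i, ∑ j, ∑ k, ∑ l,
        star (coupling P i (conjIx j) * conjSign (conjIx j)) *
          star (coupling P k (conjIx l) * conjSign (conjIx l)) *
          (phaseU Φ i a * phaseU Φ j (conjIx b) * (phaseU Φ k b * phaseU Φ l (conjIx a)))) ∂μ =
        star (∫ Φ, ∑ i, ∑ j, ∑ k, ∑ l,
        star (coupling P i (conjIx j) * conjSign (conjIx j)) *
          star (coupling P k (conjIx l) * conjSign (conjIx l)) *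
          (phaseU Φ i a * phaseU Φ j (conjIx b) * (phaseU Φ k b * phaseU Φ l (conjIx a))) ∂μ) :=
      integral_conj
    rw [integral_congr_ae hae, integral_const_mul, hc]
    have hz : ∫ Φ, ∑ i, ∑ j, ∑ k, ∑ l,
        star (coupling P i (conjIx j) * conjSign (conjIx j)) *
          star (coupling P k (conjIx l) * conjSign (conjIx l)) *
          (phaseU Φ i a * phaseU Φ j (conjIx b) * (phaseU Φ k b * phaseU Φ l (conjIx a))) ∂μ
          = 0 := by
      rw [integral_finsetSum _ fun i _ => integrable_finsetSum _ fun j _ =>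
        integrable_finsetSum _ fun k _ => integrable_finsetSum _ fun l _ => hint i j k l]
      refine Finset.sum_eq_zero fun i _ => ?_
      rw [integral_finsetSum _ fun j _ =>
        integrable_finsetSum _ fun k _ => integrable_finsetSum _ fun l _ => hint i j k l]
      refine Finset.sum_eq_zero fun j _ => ?_
      rw [integral_finsetSum _ fun k _ => integrable_finsetSum _ fun l _ => hint i j k l]
      refine Finset.sum_eq_zero fun k _ => ?_
      rw [integral_finsetSum _ fun l _ => hint i j k l]
      refine Finset.sum_eq_zero fun l _ => ?_
      rw [integral_const_mul, hU.moment_four_zero (b := conjIx b) (d := conjIx a) ha hb hb ha,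
        mul_zero]
    rw [hz]
    simp

end Model.IsGeometric

/-! ### Fourth moments in the unitary class -/

section Unitary

variable {M : Model .complex L} {μ : Measure (FMat .complex L)}

lemma Model.IsGeometric.haarPhaseV (h : M.IsGeometric μ) : HaarPhase M μ phaseV where
  meas := measurable_phaseV_apply
  mem := h.memV
  haar := by
    have hmU : Measurable (phaseU (K := .complex) (L := L)) :=
      measurable_matrix measurable_phaseU_apply
    have hmV : Measurable (phaseV (K := .complex) (L := L)) :=
      measurable_matrix measurable_phaseV_apply
    have hb : Measurable M.blockE := measurable_matrix fun (i j : M.EIx) =>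
      measurable_entry i.1 j.1
    have e1 : μ.map (fun Φ => M.blockE (phaseV Φ)) = μ.map fun Φ => M.blockE (phaseU Φ) := by
      have e2 := congrArg (Measure.map M.blockE) (h.indep rfl).2
      rw [Measure.map_map hb hmU, Measure.map_map hb hmV] at e2
      exact e2.symm
    rw [e1]
    exact h.haar
  block := by
    have hmU : Measurable (phaseU (K := .complex) (L := L)) :=
      measurable_matrix measurable_phaseU_apply
    have hmV : Measurable (phaseV (K := .complex) (L := L)) :=
      measurable_matrix measurable_phaseV_apply
    -- The block structure is only assumed for `U`; being a measurable event of full probability, it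
    -- passes to `V` by equality in law.
    have hset : MeasurableSet {X : SMat .complex L | ∀ i b, X i b =
        M.ind i * M.ind b * X i b + if i = b then 1 - M.ind i else 0} := by
      simp only [Set.ofPred_forall]
      exact MeasurableSet.iInter fun i => MeasurableSet.iInter fun b =>
        measurableSet_eq_fun (measurable_entry i b)
          (((measurable_entry i b).const_mul _).add_const _)
    have := (ae_map_iff hmU.aemeasurable hset).2 h.haarPhaseU.block
    rw [(h.indep rfl).2] at this
    exact (ae_map_iff hmV.aemeasurable hset).1 this

lemma Model.IsGeometric.integral_mul (h : M.IsGeometric μ) {F G : SMat .complex L → ℂ}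
    (hF : Measurable F) (hG : Measurable G) :
    ∫ Φ, F (phaseU Φ) * G (phaseV Φ) ∂μ = (∫ Φ, F (phaseU Φ) ∂μ) * ∫ Φ, G (phaseV Φ) ∂μ := by
  have hmU : Measurable (phaseU (K := .complex) (L := L)) :=
    measurable_matrix measurable_phaseU_apply
  have hmV : Measurable (phaseV (K := .complex) (L := L)) :=
    measurable_matrix measurable_phaseV_apply
  exact ((h.indep rfl).1.comp hF hG).integral_fun_mul_eq_mul_integral
    (hF.comp hmU).aestronglyMeasurable (hG.comp hmV).aestronglyMeasurable

/-- By independence every moment factorizes into moments of `U` and of `V` of order at most two; no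
fourth Haar moment is needed. -/
lemma Model.IsGeometric.phaseMoments_unitary (h : M.IsGeometric μ) (B : SMat .complex L) :
    PhaseMoments M μ B (fun _ _ => (Fintype.card M.EIx : ℂ)⁻¹ * (Fintype.card M.EIx : ℂ)⁻¹) := by
  have := h.prob
  have hU := h.haarPhaseU
  have hV := h.haarPhaseV
  have hst : ∀ i a, Measurable fun X : SMat .complex L => star (X i a) := fun i a =>
    continuous_star.measurable.comp (measurable_entry i a)
  refine ⟨h.memU, h.memV, hU.hyp, hV.hyp, fun a ha i j => hU.moment_two ha i j,
    fun a ha i j => hV.moment_two ha i j, ?_, ?_, ?_⟩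
  · intro a ha i j
    rw [h.integral_mul (F := fun X => star (X i a)) (hst i a) (measurable_entry j a),
      hV.moment_one ha, mul_zero]
  · intro a b ha hb
    have hexp : ∀ Φ : FMat .complex L, star (((phaseU Φ)ᴴ * B * phaseV Φ) a b) *
        ((phaseU Φ)ᴴ * B * phaseV Φ) a b = ∑ i, ∑ j, ∑ k, ∑ l, star (B i j) * B k l *
          (star (phaseU Φ k a) * phaseU Φ i a * (star (phaseV Φ j b) * phaseV Φ l b)) := by
      intro Φ
      rw [sandwich_apply]
      simp only [star_sum]
      rw [sum_sum_mul_sum_sum]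
      refine Finset.sum_congr rfl fun i _ => Finset.sum_congr rfl fun j _ =>
        Finset.sum_congr rfl fun k _ => Finset.sum_congr rfl fun l _ => ?_
      simp only [star_mul', star_star]
      ring
    have hint : ∀ i j k l, Integrable (fun Φ : FMat .complex L => star (B i j) * B k l *
          (star (phaseU Φ k a) * phaseU Φ i a * (star (phaseV Φ j b) * phaseV Φ l b))) μ :=
      fun i j k l => (MemLp.integrable_top (MemLp.mul_top
        (MemLp.mul_top (MemLp.star_top (h.memU _ _)) (h.memU _ _))
        (MemLp.mul_top (MemLp.star_top (h.memV _ _)) (h.memV _ _)))).const_mul _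
    have hval : ∀ i j k l, ∫ Φ : FMat .complex L, star (B i j) * B k l *
          (star (phaseU Φ k a) * phaseU Φ i a * (star (phaseV Φ j b) * phaseV Φ l b)) ∂μ =
          if k = i then if j = l then (Fintype.card M.EIx : ℂ)⁻¹ * (Fintype.card M.EIx : ℂ)⁻¹ *
            (M.ind i * M.ind j * (B i j * star (B i j))) else 0 else 0 := by
      intro i j k l
      rw [integral_const_mul, h.integral_mul (F := fun X => star (X k a) * X i a)
        (G := fun X => star (X j b) * X l b) ((hst k a).mul (measurable_entry i a))
        ((hst j b).mul (measurable_entry l b)), hU.moment_two ha, hV.moment_two hb]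
      by_cases h1 : k = i
      · by_cases h2 : j = l
        · subst h1; subst h2
          simp only [if_true]
          ring
        · simp [h2]
      · simp [h1]
    simp only [hexp]
    rw [integral_finsetSum _ fun i _ => integrable_finsetSum _ fun j _ =>
      integrable_finsetSum _ fun k _ => integrable_finsetSum _ fun l _ => hint i j k l,
      Model.ellWeight, Finset.mul_sum]
    refine Finset.sum_congr rfl fun i _ => ?_
    rw [integral_finsetSum _ fun j _ =>
      integrable_finsetSum _ fun k _ => integrable_finsetSum _ fun l _ => hint i j k l,
      Finset.mul_sum]
    refine Finset.sum_congr rfl fun j _ => ?_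
    rw [integral_finsetSum _ fun k _ => integrable_finsetSum _ fun l _ => hint i j k l]
    rw [Finset.sum_congr rfl fun k _ => integral_finsetSum _ fun l _ => hint i j k l]
    simp only [hval]
    rw [Finset.sum_eq_single i (by intro k _ hk; simp [hk]) (by simp),
      Finset.sum_eq_single j (by intro k _ hk; simp [Ne.symm hk]) (by simp)]
    simp
  · intro a b ha hb
    have hexp : ∀ Φ : FMat .complex L, ((phaseU Φ)ᴴ * B * phaseV Φ) a b *
        ((phaseU Φ)ᴴ * B * phaseV Φ) b a = ∑ i, ∑ j, ∑ k, ∑ l, B i j * B k l *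
          (star (phaseU Φ i a * phaseU Φ k b) * (phaseV Φ j b * phaseV Φ l a)) := by
      intro Φ
      rw [sandwich_apply, sandwich_apply]
      rw [sum_sum_mul_sum_sum]
      refine Finset.sum_congr rfl fun i _ => Finset.sum_congr rfl fun j _ =>
        Finset.sum_congr rfl fun k _ => Finset.sum_congr rfl fun l _ => ?_
      simp only [star_mul']
      ring
    have hint : ∀ i j k l, Integrable (fun Φ : FMat .complex L => B i j * B k l *
          (star (phaseU Φ i a * phaseU Φ k b) * (phaseV Φ j b * phaseV Φ l a))) μ :=
      fun i j k l => (MemLp.integrable_top (MemLp.mul_top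
        (MemLp.star_top (MemLp.mul_top (h.memU _ _) (h.memU _ _)))
        (MemLp.mul_top (h.memV _ _) (h.memV _ _)))).const_mul _
    simp only [hexp]
    rw [integral_finsetSum _ fun i _ => integrable_finsetSum _ fun j _ =>
      integrable_finsetSum _ fun k _ => integrable_finsetSum _ fun l _ => hint i j k l]
    refine Finset.sum_eq_zero fun i _ => ?_
    rw [integral_finsetSum _ fun j _ =>
      integrable_finsetSum _ fun k _ => integrable_finsetSum _ fun l _ => hint i j k l]
    refine Finset.sum_eq_zero fun j _ => ?_
    rw [integral_finsetSum _ fun k _ => integrable_finsetSum _ fun l _ => hint i j k l]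
    refine Finset.sum_eq_zero fun k _ => ?_
    rw [integral_finsetSum _ fun l _ => hint i j k l]
    refine Finset.sum_eq_zero fun l _ => ?_
    rw [integral_const_mul, h.integral_mul (F := fun X => star (X i a * X k b))
      (G := fun X => X j b * X l a)
      (continuous_star.measurable.comp ((measurable_entry i a).mul (measurable_entry k b)))
      ((measurable_entry j b).mul (measurable_entry l a)), hV.moment_two_zero hb ha, mul_zero,
      mul_zero]

end Unitary

/-! ### Evaluation of the coefficient in the three classes -/

namespace Model

/-- The coefficient of `λ²`, in units of the disorder strength. -/
noncomputable def relCoefficient (M : Model K L) (p : Fin L) : ℝ :=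
  1 / (4 * (M.Le : ℝ) * ((M.Le : ℝ) + K.deltaR - K.deltaH / 2)) *
    ((L : ℝ) - ((p : ℝ) + 1) + K.deltaC / 2 + K.deltaR + K.deltaH / 4)

/-- The average of the second order integrand over the geometric measure, at fixed `P`. -/
lemma IsGeometric.integral_density {M : Model K L} {μ : Measure (FMat K L)}
    (h : M.IsGeometric μ) {P : BMat K L} (hP : IsHS P) {p : Fin L} (hp : M.Lh ≤ p.1) :
    ∫ Φ, density p P Φ ∂μ = (4 * M.relCoefficient p : ℝ) *
      trK K (M.PiE * (Pᴴ + P) * M.PiE * P * M.PiE) := by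
  have := h.prob
  rw [M.strength_integrand hP]
  have hLe : 0 < M.Le := by unfold Le; have := p.2; omega
  have hL : (L : ℂ) = M.Le + M.Lh := by
    have : L = M.Le + M.Lh := by unfold Le; have := M.Lh_le; omega
    exact_mod_cast this
  have hn : (M.Le : ℂ) ≠ 0 := by exact_mod_cast hLe.ne'
  have hcard := M.card_EIx
  cases K with
  | complex =>
    -- Here `cd = co`: the diagonal term has half the weight of the others, whence the offset `1/2`.
    rw [PhaseMoments.integral_density hP (h.phaseMoments_unitary (coupling P)) hp
      (cd := (Fintype.card M.EIx : ℂ)⁻¹ * (Fintype.card M.EIx : ℂ)⁻¹)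
      (co := (Fintype.card M.EIx : ℂ)⁻¹ * (Fintype.card M.EIx : ℂ)⁻¹) (by simp; ring)
      (by intros; simp; ring), hcard]
    simp only [relCoefficient, SymClass.deltaR, SymClass.deltaC, SymClass.deltaH, SymClass.dim]
    push_cast
    rw [hL]
    field_simp
    ring
  | real =>
    have hn1 : (M.Le : ℂ) + 1 ≠ 0 := by exact_mod_cast M.Le.succ_ne_zero
    -- Here `N = L_e`, `s = 1` and the index conjugation is trivial; symmetry doubles the diagonal
    -- moment, so `cd = 2 co`.
    rw [PhaseMoments.integral_density hP (h.phaseMoments_conj (by simp) hP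
      (by rw [hcard]; simpa using hn1)) hp
      (cd := 2 * (M.Le : ℂ)⁻¹ / (M.Le + 1)) (co := (M.Le : ℂ)⁻¹ / (M.Le + 1)) ?_ ?_, hcard]
    · simp only [relCoefficient, SymClass.deltaR, SymClass.deltaC, SymClass.deltaH, SymClass.dim]
      push_cast
      rw [hL]
      simp only [mul_one, add_zero, zero_div, sub_zero]
      field_simp
      ring
    · simp [conjCoeff, hcard, conjIx]
      ring
    · intro q _ hq
      simp [conjCoeff, hcard, conjIx, hq.ne, hq.ne']
      ring
  | quaternion =>
    have hn1 : (2 * (M.Le : ℂ) - 1) ≠ 0 := by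
      intro hh
      have : (2 * (M.Le : ℝ) - 1) = 0 := by exact_mod_cast hh
      have h1 : (1 : ℝ) ≤ M.Le := by exact_mod_cast hLe
      linarith
    -- Here `N = 2 L_e` and `s = -1`. Of the four component pairs of a block, antisymmetry kills two
    -- when `q = p` and none when `q < p`, so `cd = co / 2`.
    rw [PhaseMoments.integral_density hP (h.phaseMoments_conj (by simp) hP ?_) hp
      (cd := 2 * (2 * M.Le : ℂ)⁻¹ / (2 * M.Le - 1))
      (co := 4 * (2 * M.Le : ℂ)⁻¹ / (2 * M.Le - 1)) ?_ ?_, hcard]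
    · simp only [relCoefficient, SymClass.deltaR, SymClass.deltaC, SymClass.deltaH, SymClass.dim]
      push_cast
      rw [hL]
      have hn2 : ((M.Le : ℂ) + 0 - 1 / 2) = (2 * M.Le - 1) / 2 := by ring
      rw [hn2]
      field_simp
      ring
    · rw [hcard]
      intro hh
      apply hn1
      rw [← hh]
      push_cast
      norm_num
      ring
    · simp [conjCoeff, hcard, conjIx, Fin.sum_univ_two, Fin.rev]
      ring
    · intro q _ hq
      simp [conjCoeff, hcard, conjIx, Fin.rev, hq.ne, hq.ne']
      ring

end Model

end RandomPhase

namespace RandomPhase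

variable {K : SymClass} {L : ℕ}

/-! ### The second order expression as a function on the flag manifold -/

section Projection

/-- The projection on the `p`-th column of a frame. -/
noncomputable def colProj (Φ : FMat K L) (p : Fin L) : BMat K L := col Φ p * (col Φ p)ᴴ

lemma entry_sandwich (Φ : FMat K L) (X : BMat K L) (p q : Fin L) :
    entry (Φᴴ * X * Φ) p q = (col Φ p)ᴴ * X * col Φ q := by
  ext s t
  simp only [entry, col, Matrix.of_apply, Matrix.mul_apply, Matrix.conjTranspose_apply]

/-- By cyclicity of the trace the integrand depends on the frame only through the column
projections. They are gauge invariant and polynomial in the real and imaginary parts of the entries,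
which is what an admissible observable requires. -/
lemma density_eq_trace (p : Fin L) (P : BMat K L) (Φ : FMat K L) :
    density p P Φ = (K.dim : ℂ)⁻¹ *
      ((((2 : ℂ) • (Pᴴ * P) + P * P + Pᴴ * Pᴴ) * colProj Φ p).trace -
        ∑ q ∈ Finset.Iic p, (if q = p then (1 : ℂ) else 2) *
          ((Pᴴ + P) * colProj Φ q * ((Pᴴ + P) * colProj Φ p)).trace) := by
  unfold density trK
  rw [Matrix.trace_sub, Matrix.trace_sum]
  simp only [Matrix.trace_smul, smul_eq_mul, entry_sandwich]
  congr 2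
  · rw [Matrix.mul_assoc, Matrix.trace_mul_comm, Matrix.mul_assoc]
    rfl
  · refine Finset.sum_congr rfl fun q _ => ?_
    congr 1
    simp only [Matrix.mul_assoc, colProj]
    rw [Matrix.trace_mul_comm]
    simp only [Matrix.mul_assoc]

lemma density_eq_sum_proj (p : Fin L) (P : BMat K L) (Φ : FMat K L) :
    density p P Φ = (K.dim : ℂ)⁻¹ *
      ((∑ i, ∑ j, ((2 : ℂ) • (Pᴴ * P) + P * P + Pᴴ * Pᴴ) i j * colProj Φ p j i) -
        ∑ q ∈ Finset.Iic p, (if q = p then (1 : ℂ) else 2) *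
          ∑ i, ∑ j, ∑ k, ∑ l, (Pᴴ + P) i j * (Pᴴ + P) k l *
            (colProj Φ q j k * colProj Φ p l i)) := by
  rw [density_eq_trace]
  congr 2
  refine Finset.sum_congr rfl fun q _ => ?_
  congr 1
  simp only [Matrix.trace, Matrix.diag_apply]
  refine Finset.sum_congr rfl fun i _ => ?_
  rw [Matrix.mul_apply]
  have : ∀ k, ((Pᴴ + P) * colProj Φ q) i k * ((Pᴴ + P) * colProj Φ p) k i =
      ∑ j, ∑ l, (Pᴴ + P) i j * (Pᴴ + P) k l * (colProj Φ q j k * colProj Φ p l i) := by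
    intro k
    rw [Matrix.mul_apply, Matrix.mul_apply, Finset.sum_mul_sum]
    refine Finset.sum_congr rfl fun j _ => Finset.sum_congr rfl fun l _ => ?_
    ring
  simp only [this]
  exact Finset.sum_comm

lemma colProj_apply (Φ : FMat K L) (p : Fin L) (i j : Ix K L ⊕ Ix K L) :
    colProj Φ p i j = ∑ t, Φ i (p, t) * star (Φ j (p, t)) := by
  simp only [colProj, Matrix.mul_apply, col, Matrix.of_apply, Matrix.conjTranspose_apply]

/-- A gauge multiplies the column `φ_p` from the right by a unitary block, which cancels in `φ_p
φ_p*`. -/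
lemma colProj_gauge (Φ : FMat K L) {D : SMat K L} (hD : IsGauge D) (p : Fin L) :
    colProj (Φ * D) p = colProj Φ p := by
  obtain ⟨-, h1, h2⟩ := hD
  have h2' : ∀ q s t, q ≠ p → D (q, s) (p, t) = 0 := fun q s t hq =>
    congrFun (congrFun (h2 q p hq) s) t
  have hcol : col (Φ * D) p = col Φ p * entry D p p := by
    ext i s
    simp only [col, entry, Matrix.of_apply, Matrix.mul_apply, Fintype.sum_prod_type]
    rw [Finset.sum_eq_single p]
    · intro q _ hq
      exact Finset.sum_eq_zero fun t _ => by rw [h2' q t s hq, mul_zero]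
    · simp
  have hu : (entry D p p)ᴴ * entry D p p = 1 := by
    ext s t
    have := congrFun (congrFun h1 (p, s)) (p, t)
    simp only [Matrix.mul_apply, Fintype.sum_prod_type, Matrix.conjTranspose_apply] at this
    rw [Finset.sum_eq_single p] at this
    · simp only [Matrix.mul_apply, entry, Matrix.conjTranspose_apply, Matrix.of_apply]
      rw [this]
      simp [Matrix.one_apply]
    · intro q _ hq
      exact Finset.sum_eq_zero fun r _ => by rw [h2' q r t hq, mul_zero]
    · simp
  have hu' : entry D p p * (entry D p p)ᴴ = 1 := mul_eq_one_comm.1 hu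
  rw [colProj, hcol, Matrix.conjTranspose_mul, Matrix.mul_assoc, ← Matrix.mul_assoc _ _ (col Φ p)ᴴ,
    hu', Matrix.one_mul, colProj]

lemma contDiff_colProj (p : Fin L) (i j : Ix K L ⊕ Ix K L) :
    ContDiff ℝ ∞ fun x : Ix K L ⊕ Ix K L → Ix K L → ℂ => colProj (Matrix.of x) p i j := by
  simp only [colProj_apply, Matrix.of_apply]
  refine ContDiff.sum fun t _ => ?_
  have h : ∀ i a, ContDiff ℝ ∞ fun x : Ix K L ⊕ Ix K L → Ix K L → ℂ => x i a := fun i a =>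
    contDiff_apply_apply ℝ ℂ i a
  exact (h i _).mul (Complex.conjCLE.contDiff.comp (h j _))

lemma IsFrame.norm_entry_le {Φ : FMat K L} (h : IsFrame Φ) (i : Ix K L ⊕ Ix K L) (a : Ix K L) :
    ‖Φ i a‖ ≤ 1 := by
  cases i with
  | inl i =>
    have hU := entry_norm_bound_of_unitary h.phaseU_mem i a
    have hV := entry_norm_bound_of_unitary h.phaseV_mem i a
    have e : Φ (Sum.inl i) a = (phaseU Φ i a + phaseV Φ i a) / 2 := by
      rw [phaseU_apply, phaseV_apply]; ring
    rw [e, norm_div]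
    have := norm_add_le (phaseU Φ i a) (phaseV Φ i a)
    norm_num
    linarith
  | inr i =>
    have hU := entry_norm_bound_of_unitary h.phaseU_mem i a
    have hV := entry_norm_bound_of_unitary h.phaseV_mem i a
    have e : Complex.I * Φ (Sum.inr i) a = (phaseV Φ i a - phaseU Φ i a) / 2 := by
      rw [phaseU_apply, phaseV_apply]; ring
    have e' : ‖Φ (Sum.inr i) a‖ = ‖(phaseV Φ i a - phaseU Φ i a) / 2‖ := by
      rw [← e, norm_mul, Complex.norm_I, one_mul]
    rw [e', norm_div]
    have := norm_sub_le (phaseV Φ i a) (phaseU Φ i a)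
    norm_num
    linarith

lemma memLp_colProj {μ : Measure (FMat K L)} (h : ∀ᵐ Φ ∂μ, IsFrame Φ) (p : Fin L)
    (i j : Ix K L ⊕ Ix K L) : MemLp (fun Φ : FMat K L => colProj Φ p i j) ⊤ μ := by
  have he : ∀ i a, MemLp (fun Φ : FMat K L => Φ i a) ⊤ μ := fun i a =>
    memLp_top_of_bound (measurable_entry i a).aestronglyMeasurable 1
      (by filter_upwards [h] with Φ hΦ using hΦ.norm_entry_le i a)
  simp only [colProj_apply]
  exact memLp_finsetSum _ fun t _ => MemLp.mul_top (he i _) (MemLp.star_top (he j _))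

end Projection

/-! ### From the invariant measure to the geometric measure -/

namespace Model

variable (M : Model K L)

lemma integrable_entry_mul (i j k l : Ix K L ⊕ Ix K L) :
    Integrable (fun P : BMat K L => (Pᴴ + P) i j * (Pᴴ + P) k l) M.law := by
  have h : ∀ i j, MemLp (fun P : BMat K L => (Pᴴ + P) i j) 2 M.law := fun i j =>
    (M.law_sq j i).star.add (M.law_sq i j)
  exact (h i j).integrable_mul (h k l)

lemma integrable_quadratic (i j : Ix K L ⊕ Ix K L) :
    Integrable (fun P : BMat K L => ((2 : ℂ) • (Pᴴ * P) + P * P + Pᴴ * Pᴴ) i j) M.law := by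
  simp only [Matrix.add_apply, Matrix.smul_apply, smul_eq_mul, Matrix.mul_apply,
    Matrix.conjTranspose_apply]
  exact (((integrable_finsetSum _ fun k _ =>
    ((M.law_sq k i).star.integrable_mul (M.law_sq k j))).const_mul _).add
    (integrable_finsetSum _ fun k _ => (M.law_sq i k).integrable_mul (M.law_sq k j))).add
    (integrable_finsetSum _ fun k _ => (M.law_sq k i).star.integrable_mul (M.law_sq j k).star)

/-- Each term is an integrable function of `P`, by square integrability of the entries, times a
bounded function of the frame. -/
lemma integrable_density {μ : Measure (FMat K L)} [IsProbabilityMeasure μ]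
    (h : ∀ᵐ Φ ∂μ, IsFrame Φ) (p : Fin L) :
    Integrable (fun x : BMat K L × FMat K L => density p x.1 x.2) (M.law.prod μ) := by
  simp only [density_eq_sum_proj]
  refine Integrable.const_mul (Integrable.sub ?_ ?_) _
  · exact integrable_finsetSum _ fun i _ => integrable_finsetSum _ fun j _ =>
      (M.integrable_quadratic i j).mul_prod (MemLp.integrable_top (memLp_colProj h p j i))
  · refine integrable_finsetSum _ fun q _ => Integrable.const_mul ?_ _
    exact integrable_finsetSum _ fun i _ => integrable_finsetSum _ fun j _ =>
      integrable_finsetSum _ fun k _ => integrable_finsetSum _ fun l _ =>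
      (M.integrable_entry_mul i j k l).mul_prod (MemLp.integrable_top
        (MemLp.mul_top (memLp_colProj h q j k) (memLp_colProj h p l i)))

lemma integrable_density_law (p : Fin L) (Φ : FMat K L) :
    Integrable (fun P => density p P Φ) M.law := by
  simp only [density_eq_sum_proj]
  refine Integrable.const_mul (Integrable.sub ?_ ?_) _
  · exact integrable_finsetSum _ fun i _ => integrable_finsetSum _ fun j _ =>
      (M.integrable_quadratic i j).mul_const _
  · refine integrable_finsetSum _ fun q _ => Integrable.const_mul ?_ _
    exact integrable_finsetSum _ fun i _ => integrable_finsetSum _ fun j _ =>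
      integrable_finsetSum _ fun k _ => integrable_finsetSum _ fun l _ =>
      (M.integrable_entry_mul i j k l).mul_const _

/-- The average of the second order integrand over `P`, as a function of the frame. -/
noncomputable def meanDensity (p : Fin L) (Φ : FMat K L) : ℝ := ∫ P, (density p P Φ).re ∂M.law

/-- Only second moments of `P` enter, as coefficients of a polynomial in the projections. The
identity holds for arbitrary matrices `Φ`, so smoothness follows on the whole ambient space. -/
lemma meanDensity_eq (p : Fin L) (Φ : FMat K L) :
    M.meanDensity p Φ = ((K.dim : ℂ)⁻¹ *
      ((∑ i, ∑ j, (∫ P : BMat K L, ((2 : ℂ) • (Pᴴ * P) + P * P + Pᴴ * Pᴴ) i j ∂M.law) *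
        colProj Φ p j i) -
        ∑ q ∈ Finset.Iic p, (if q = p then (1 : ℂ) else 2) *
          ∑ i, ∑ j, ∑ k, ∑ l, (∫ P : BMat K L, (Pᴴ + P) i j * (Pᴴ + P) k l ∂M.law) *
            (colProj Φ q j k * colProj Φ p l i))).re := by
  have hre : M.meanDensity p Φ = (∫ P, density p P Φ ∂M.law).re :=
    integral_re (M.integrable_density_law p Φ)
  have i1 : ∀ i j, Integrable (fun P : BMat K L =>
      ((2 : ℂ) • (Pᴴ * P) + P * P + Pᴴ * Pᴴ) i j * colProj Φ p j i) M.law := fun i j =>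
    (M.integrable_quadratic i j).mul_const _
  have i2 : ∀ q i j k l, Integrable (fun P : BMat K L => (Pᴴ + P) i j * (Pᴴ + P) k l *
      (colProj Φ q j k * colProj Φ p l i)) M.law := fun q i j k l =>
    (M.integrable_entry_mul i j k l).mul_const _
  rw [hre]
  simp only [density_eq_sum_proj]
  congr 1
  rw [integral_const_mul, integral_sub (integrable_finsetSum _ fun i _ =>
    integrable_finsetSum _ fun j _ => i1 i j) (integrable_finsetSum _ fun q _ =>
    (integrable_finsetSum _ fun i _ => integrable_finsetSum _ fun j _ =>
      integrable_finsetSum _ fun k _ => integrable_finsetSum _ fun l _ =>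
        i2 q i j k l).const_mul _)]
  congr 2
  · rw [integral_finsetSum _ fun i _ => integrable_finsetSum _ fun j _ => i1 i j]
    refine Finset.sum_congr rfl fun i _ => ?_
    rw [integral_finsetSum _ fun j _ => i1 i j]
    exact Finset.sum_congr rfl fun j _ => integral_mul_const _ _
  · rw [integral_finsetSum _ fun q _ =>
    (integrable_finsetSum _ fun i _ => integrable_finsetSum _ fun j _ =>
      integrable_finsetSum _ fun k _ => integrable_finsetSum _ fun l _ =>
        i2 q i j k l).const_mul _]
    refine Finset.sum_congr rfl fun q _ => ?_
    rw [integral_const_mul, integral_finsetSum _ fun i _ => integrable_finsetSum _ fun j _ =>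
      integrable_finsetSum _ fun k _ => integrable_finsetSum _ fun l _ => i2 q i j k l]
    congr 1
    refine Finset.sum_congr rfl fun i _ => ?_
    rw [integral_finsetSum _ fun j _ =>
      integrable_finsetSum _ fun k _ => integrable_finsetSum _ fun l _ => i2 q i j k l]
    refine Finset.sum_congr rfl fun j _ => ?_
    rw [integral_finsetSum _ fun k _ => integrable_finsetSum _ fun l _ => i2 q i j k l]
    refine Finset.sum_congr rfl fun k _ => ?_
    rw [integral_finsetSum _ fun l _ => i2 q i j k l]
    exact Finset.sum_congr rfl fun l _ => integral_mul_const _ _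

lemma contDiff_meanDensity (p : Fin L) : ContDiff ℝ ∞
    fun x : Ix K L ⊕ Ix K L → Ix K L → ℂ => M.meanDensity p (Matrix.of x) := by
  simp only [meanDensity_eq]
  refine Complex.reCLM.contDiff.comp (contDiff_const.mul (ContDiff.sub ?_ ?_))
  · exact ContDiff.sum fun i _ => ContDiff.sum fun j _ =>
      contDiff_const.mul (contDiff_colProj p j i)
  · refine ContDiff.sum fun q _ => contDiff_const.mul ?_
    exact ContDiff.sum fun i _ => ContDiff.sum fun j _ => ContDiff.sum fun k _ =>
      ContDiff.sum fun l _ =>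
      contDiff_const.mul ((contDiff_colProj q j k).mul (contDiff_colProj p l i))

lemma meanDensity_gauge (p : Fin L) (Φ : FMat K L) {D : SMat K L} (hD : IsGauge D) :
    M.meanDensity p (Φ * D) = M.meanDensity p Φ := by
  simp only [meanDensity_eq, colProj_gauge Φ hD]

lemma secondOrder_eq {μ : Measure (FMat K L)} [IsProbabilityMeasure μ]
    (h : ∀ᵐ Φ ∂μ, IsFrame Φ) (lam : ℝ) (p : Fin L) :
    M.secondOrder μ lam p = lam ^ 2 / 4 * ∫ Φ, M.meanDensity p Φ ∂μ := by
  have := integral_prod_symm (fun x : BMat K L × FMat K L => (density p x.1 x.2).re)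
    (M.integrable_density h p).re
  unfold secondOrder meanDensity
  rw [← this]
  rfl

/-- Fubini allows the frame to be averaged first, at fixed `P`, where the moment computation
applies; the remaining average over `P` produces `T`. -/
lemma IsGeometric.integral_meanDensity {μ : Measure (FMat K L)} (h : M.IsGeometric μ)
    {p : Fin L} (hp : M.Lh ≤ p.1) :
    ∫ Φ, M.meanDensity p Φ ∂μ = 4 * M.coefficient p := by
  have := h.prob
  have hint := M.integrable_density h.frame p
  have e1 := integral_prod_symm (fun x : BMat K L × FMat K L => (density p x.1 x.2).re) hint.re
  have e2 := integral_prod (fun x : BMat K L × FMat K L => (density p x.1 x.2).re) hint.re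
  unfold meanDensity
  rw [← e1, e2]
  have e3 : ∀ᵐ P ∂M.law, ∫ Φ, (density p P Φ).re ∂μ = 4 * M.relCoefficient p *
      (trK K (M.PiE * (Pᴴ + P) * M.PiE * P * M.PiE)).re := by
    filter_upwards [M.law_hs, hint.prod_right_ae] with P hP hPi
    have e4 : ∫ Φ, (density p P Φ).re ∂μ = (∫ Φ, density p P Φ ∂μ).re := integral_re hPi
    rw [e4, h.integral_density hP hp, Complex.re_ofReal_mul]
  rw [integral_congr_ae e3, integral_const_mul]
  unfold coefficient relCoefficient strength
  ring

/-- The second order expression under the random phase property. -/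
lemma secondOrder_isBigO (hM : M.RandomPhaseProperty) (μ : ℝ → Measure (FMat K L))
    (hμ : ∀ᶠ lam : ℝ in 𝓝[>] 0, M.IsInvariant lam (μ lam)) {p : Fin L} (hp : M.Lh ≤ p.1) :
    (fun lam : ℝ => M.secondOrder (μ lam) lam p - lam ^ 2 * M.coefficient p)
      =O[𝓝[>] 0] fun lam : ℝ => lam ^ 3 := by
  obtain ⟨-, μ₀, h0, hcl⟩ := hM
  have h1 := hcl (M.meanDensity p) (M.contDiff_meanDensity p)
    (fun Φ D _ hD => M.meanDensity_gauge p Φ hD) μ hμ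
  have h2 : (fun lam : ℝ => lam ^ 2 / 4 *
      (∫ Φ, M.meanDensity p Φ ∂(μ lam) - ∫ Φ, M.meanDensity p Φ ∂μ₀)) =O[𝓝[>] 0]
      fun lam : ℝ => lam ^ 2 * lam ^ 2 := by
    refine IsBigO.mul ?_ h1
    simp only [div_eq_inv_mul]
    exact isBigO_const_mul_self _ _ _
  -- The replacement of the measure costs only `O(λ⁴)`, which is better than needed.
  have h3 : (fun lam : ℝ => lam ^ 2 * lam ^ 2) =O[𝓝[>] 0] fun lam : ℝ => lam ^ 3 := by
    simp only [← pow_add]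
    exact ((isLittleO_pow_pow (𝕜 := ℝ) (by norm_num : 3 < 2 + 2)).isBigO).mono nhdsWithin_le_nhds
  refine IsBigO.congr' (h2.trans h3) ?_ EventuallyEq.rfl
  filter_upwards [hμ] with lam hlam
  have := hlam.1
  rw [M.secondOrder_eq hlam.2.1, h0.integral_meanDensity M hp]
  ring

lemma exponent_isBigO (hM : M.RandomPhaseProperty) {μ : ℝ → Measure (FMat K L)}
    {γ : ℝ → Fin L → ℝ} (hγ : M.ExponentsGivenBy μ γ) {p : Fin L} (hp : M.Lh ≤ p.1) :
    (fun lam : ℝ => γ lam p - lam ^ 2 * M.coefficient p) =O[𝓝[>] 0] fun lam : ℝ => lam ^ 3 := by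
  refine ((hγ.2 p hp).2.add (M.secondOrder_isBigO hM μ hγ.1 hp)).congr_left fun lam => ?_
  ring

lemma exponent_tendsto (hM : M.RandomPhaseProperty) {μ : ℝ → Measure (FMat K L)}
    {γ : ℝ → Fin L → ℝ} (hγ : M.ExponentsGivenBy μ γ) {p : Fin L} (hp : M.Lh ≤ p.1) :
    Tendsto (fun lam : ℝ => γ lam p / lam ^ 2) (𝓝[>] 0) (𝓝 (M.coefficient p)) := by
  have h1 := (M.exponent_isBigO hM hγ hp).trans_isLittleO
    ((isLittleO_pow_pow (𝕜 := ℝ) (by norm_num : 2 < 3)).mono nhdsWithin_le_nhds)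
  have h2 := h1.tendsto_div_nhds_zero.add_const (M.coefficient p)
  rw [zero_add] at h2
  refine h2.congr' ?_
  filter_upwards [self_mem_nhdsWithin] with lam hlam
  have : lam ≠ 0 := ne_of_gt hlam
  field_simp
  ring

lemma coefficient_last {p : Fin L} (hp : p.1 + 1 = L) : M.coefficient p =
    1 / (4 * (M.Le : ℝ) * ((M.Le : ℝ) + K.deltaR - K.deltaH / 2)) *
      (K.deltaC / 2 + K.deltaR + K.deltaH / 4) * M.strength := by
  have : (L : ℝ) = (p : ℝ) + 1 := by exact_mod_cast hp.symm
  unfold coefficient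
  rw [this]
  ring

end Model

lemma tendsto_inv_div_inv {f g : ℝ → ℝ} {a b : ℝ}
    (hf : Tendsto (fun x => f x / x ^ 2) (𝓝[>] 0) (𝓝 a))
    (hg : Tendsto (fun x => g x / x ^ 2) (𝓝[>] 0) (𝓝 b)) (ha : a ≠ 0) :
    Tendsto (fun x => (f x)⁻¹ / (g x)⁻¹) (𝓝[>] 0) (𝓝 (b / a)) := by
  refine (hg.div hf ha).congr' ?_
  filter_upwards [self_mem_nhdsWithin] with x hx
  have : x ≠ 0 := ne_of_gt hx
  rw [Pi.div_apply, div_div_div_cancel_right₀ (pow_ne_zero 2 this), inv_div_inv]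

end RandomPhase

/-! ### The theorem: expansion, equidistance and ratios of localization lengths -/

open RandomPhase in
theorem theorem1 :
    -- the second order expression, the Lyapunov exponents and their equidistance
    (∀ (K : SymClass) (L : ℕ) (M : Model K L), M.RandomPhaseProperty →
      ∀ μ : ℝ → Measure (FMat K L),
        (∀ᶠ lam : ℝ in 𝓝[>] 0, M.IsInvariant lam (μ lam)) →
        (∀ p : Fin L, M.Lh ≤ p.1 →
          (fun lam : ℝ => M.secondOrder (μ lam) lam p - lam ^ 2 * M.coefficient p)
            =O[𝓝[>] 0] fun lam : ℝ => lam ^ 3) ∧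
        ∀ γ : ℝ → Fin L → ℝ, M.ExponentsGivenBy μ γ →
          (∀ p : Fin L, M.Lh ≤ p.1 →
            (fun lam : ℝ => γ lam p - lam ^ 2 * M.coefficient p)
              =O[𝓝[>] 0] fun lam : ℝ => lam ^ 3) ∧
          (∀ p p' : Fin L, M.Lh ≤ p.1 → p'.1 = p.1 + 1 →
            (fun lam : ℝ => γ lam p - γ lam p' - lam ^ 2 * M.spacing)
              =O[𝓝[>] 0] fun lam : ℝ => lam ^ 3)) ∧
    -- the localization lengths (inverses of the smallest exponents) for `n` elliptic channels
    (∀ (n LR LC LH : ℕ) (MR : Model .real LR) (MC : Model .complex LC)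
      (MH : Model .quaternion LH),
      0 < n → MR.Le = n → MC.Le = n → MH.Le = n →
      0 < MC.strength → MR.strength = MC.strength → MH.strength = MC.strength →
      MR.RandomPhaseProperty → MC.RandomPhaseProperty → MH.RandomPhaseProperty →
      ∀ (μR : ℝ → Measure (FMat .real LR)) (μC : ℝ → Measure (FMat .complex LC))
        (μH : ℝ → Measure (FMat .quaternion LH))
        (γR : ℝ → Fin LR → ℝ) (γC : ℝ → Fin LC → ℝ) (γH : ℝ → Fin LH → ℝ),
      MR.ExponentsGivenBy μR γR → MC.ExponentsGivenBy μC γC → MH.ExponentsGivenBy μH γH →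
      ∀ (pR : Fin LR) (pC : Fin LC) (pH : Fin LH),
        pR.1 + 1 = LR → pC.1 + 1 = LC → pH.1 + 1 = LH →
        Tendsto (fun lam : ℝ => (γC lam pC)⁻¹ / (γR lam pR)⁻¹) (𝓝[>] 0)
          (𝓝 (2 * (n : ℝ) / ((n : ℝ) + 1))) ∧
        Tendsto (fun lam : ℝ => (γH lam pH)⁻¹ / (γC lam pC)⁻¹) (𝓝[>] 0)
          (𝓝 ((2 * (n : ℝ) - 1) / (n : ℝ)))) ∧
    Tendsto (fun n : ℕ => 2 * (n : ℝ) / ((n : ℝ) + 1)) atTop (𝓝 2) ∧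
    Tendsto (fun n : ℕ => (2 * (n : ℝ) - 1) / (n : ℝ)) atTop (𝓝 2) := by
  refine ⟨?_, ?_, ?_, ?_⟩
  · intro K L M hM μ hμ
    refine ⟨fun p hp => M.secondOrder_isBigO hM μ hμ hp, fun γ hγ =>
      ⟨fun p hp => M.exponent_isBigO hM hγ hp, fun p p' hp hpp => ?_⟩⟩
    refine ((M.exponent_isBigO hM hγ hp).sub
      (M.exponent_isBigO hM hγ (p := p') (by omega))).congr_left fun lam => ?_
    have hcast : (p' : ℝ) = (p : ℝ) + 1 := by exact_mod_cast hpp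
    have : M.coefficient p - M.coefficient p' = M.spacing := by
      unfold Model.coefficient Model.spacing
      rw [hcast]
      ring
    rw [← this]
    ring
  · intro n LR LC LH MR MC MH hn hR hC hH hT hTR hTH rR rC rH μR μC μH γR γC γH eR eC eH
      pR pC pH lR lC lH
    have tR := MR.exponent_tendsto rR eR (p := pR) (by unfold Model.Le at hR; omega)
    have tC := MC.exponent_tendsto rC eC (p := pC) (by unfold Model.Le at hC; omega)
    have tH := MH.exponent_tendsto rH eH (p := pH) (by unfold Model.Le at hH; omega)
    rw [MR.coefficient_last lR, hR, hTR] at tR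
    rw [MC.coefficient_last lC, hC] at tC
    rw [MH.coefficient_last lH, hH, hTH] at tH
    simp only [SymClass.deltaR, SymClass.deltaC, SymClass.deltaH] at tR tC tH
    have hn0 : (0 : ℝ) < n := by exact_mod_cast hn
    have hn1 : (1 : ℝ) ≤ n := by exact_mod_cast hn
    have hT0 := hT.ne'
    -- The symplectic denominator `n - 1/2`, in the form left by the Kronecker deltas, is named so
    -- that its positivity, due to `n ≥ 1`, can be used as a hypothesis.
    obtain ⟨d, hd⟩ : ∃ d : ℝ, d = n + 0 - 1 / 2 := ⟨_, rfl⟩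
    have hd0 : 0 < d := by linarith
    have hd1 : 2 * (n : ℝ) - 1 = 2 * d := by linarith
    rw [← hd] at tH
    rw [hd1]
    simp only [zero_div, sub_zero, add_zero, zero_add] at tR tC tH
    constructor
    · convert tendsto_inv_div_inv tC tR (by positivity) using 2
      field_simp
    · convert tendsto_inv_div_inv tH tC (by positivity) using 2
      field_simp
      ring
  · have h := (tendsto_natCast_div_add_atTop (1 : ℝ)).const_mul 2
    simpa [mul_div_assoc] using h
  · have h := (tendsto_inv_atTop_nhds_zero_nat (𝕜 := ℝ)).const_sub 2
    rw [sub_zero] at h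
    refine h.congr' ?_
    filter_upwards [eventually_gt_atTop 0] with n hn
    have : (n : ℝ) ≠ 0 := by exact_mod_cast hn.ne'
    field_simp
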